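/- Let $d\ge 2$ be an integer and let $\zeta\in\mathbb{C}$ be a primitive $d$-th root of unity. Let $B$ be the Taft algebra, i.e. the $\mathbb{C}$-algebra with generators $K,E$ and relations $K^d=1$, $E^d=0$, $KE=\zeta EK$, and let $D(B)$ be its Drinfeld double, i.e. the $\mathbb{C}$-algebra with generators $E,F,K,z$ and relations $$K^d=z^d=1,\quad E^d=F^d=0,\quad [z,E]=[z,F]=[z,K]=0,\quad KE=\zeta EK,\quad KF=\zeta^{-1}FK,\quad [E,F]=K-zK^{-1},$$ which receives $B$ by $K\mapsto K$, $E\mapsto E$. Let $D(B)\text{-mod}$ be the category of finite-dimensional left $D(B)$-modules and let $D(B)\text{-stab}$ be the stable category, i.e. the additive quotient of $D(B)\text{-mod}$ by the full subcategory of projective modules (morphisms are taken modulo those that factor through a projective module). The category $D(B)\text{-stab}$ carries its standard triangulated structure: every short exact sequence $0\to M\to N\to L\to 0$ in $D(B)\text{-mod}$ has a connecting morphism $L\to M[1]$ in $D(B)\text{-stab}$, natural in the sequence, and the distinguished triangles are the triangles isomorphic to the resulting triangles $M\to N\to L\to M[1]$ (in particular $M[1]\simeq I/M$ whenever $M$ is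 embedded in an injective module $I$). Let $D(B)\text{-proj}_B$ be the full subcategory of $D(B)\text{-mod}$ whose objects are the modules whose restriction to $B$ is a projective $B$-module. Then the image of $D(B)\text{-proj}_B$ in $D(B)\text{-stab}$ is a thick triangulated subcategory of $D(B)\text{-stab}$: it is a full subcategory which contains $0$ and is closed under isomorphisms, under the shift and its inverse, under extensions (hence under cones) and under direct summands. In particular, the (Verdier) quotient $D(B)\text{-stab}_B$ of $D(B)\text{-stab}$ by this subcategory is triangulated, and the quotient functor $D(B)\text{-stab}\to D(B)\text{-stab}_B$ is a triangulated functor. -/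

import Mathlib

open CategoryTheory CategoryTheory.Limits CategoryTheory.Pretriangulated

/-! ### The Taft algebra and its Drinfeld double -/

/-- Generators of the Taft algebra. -/
inductive TaftGen : Type
  | K | E

/-- Defining relations of the Taft algebra: `K ^ d = 1`, `E ^ d = 0`, `K E = ζ E K`. -/
inductive TaftRel (d : ℕ) (ζ : ℂ) : FreeAlgebra ℂ TaftGen → FreeAlgebra ℂ TaftGen → Prop
  | K_pow : TaftRel d ζ (FreeAlgebra.ι ℂ TaftGen.K ^ d) 1
  | E_pow : TaftRel d ζ (FreeAlgebra.ι ℂ TaftGen.E ^ d) 0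
  | K_E : TaftRel d ζ (FreeAlgebra.ι ℂ TaftGen.K * FreeAlgebra.ι ℂ TaftGen.E)
      (ζ • (FreeAlgebra.ι ℂ TaftGen.E * FreeAlgebra.ι ℂ TaftGen.K))

/-- The Taft algebra `B`. -/
abbrev TaftAlg (d : ℕ) (ζ : ℂ) : Type := RingQuot (TaftRel d ζ)

/-- Generators of the Drinfeld double of the Taft algebra. -/
inductive TaftDoubleGen : Type
  | E | F | K | z

/-- Defining relations of the Drinfeld double of the Taft algebra: `K ^ d = z ^ d = 1`,
`E ^ d = F ^ d = 0`, `z` is central, `K E = ζ E K`, `K F = ζ⁻¹ F K` and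
`E F - F E = K - z K⁻¹`, where `K⁻¹ = K ^ (d - 1)` (for `1 ≤ d`). -/
inductive TaftDoubleRel (d : ℕ) (ζ : ℂ) :
    FreeAlgebra ℂ TaftDoubleGen → FreeAlgebra ℂ TaftDoubleGen → Prop
  | K_pow : TaftDoubleRel d ζ (FreeAlgebra.ι ℂ TaftDoubleGen.K ^ d) 1
  | z_pow : TaftDoubleRel d ζ (FreeAlgebra.ι ℂ TaftDoubleGen.z ^ d) 1
  | E_pow : TaftDoubleRel d ζ (FreeAlgebra.ι ℂ TaftDoubleGen.E ^ d) 0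
  | F_pow : TaftDoubleRel d ζ (FreeAlgebra.ι ℂ TaftDoubleGen.F ^ d) 0
  | z_comm (g : TaftDoubleGen) : TaftDoubleRel d ζ
      (FreeAlgebra.ι ℂ TaftDoubleGen.z * FreeAlgebra.ι ℂ g)
      (FreeAlgebra.ι ℂ g * FreeAlgebra.ι ℂ TaftDoubleGen.z)
  | K_E : TaftDoubleRel d ζ
      (FreeAlgebra.ι ℂ TaftDoubleGen.K * FreeAlgebra.ι ℂ TaftDoubleGen.E)
      (ζ • (FreeAlgebra.ι ℂ TaftDoubleGen.E * FreeAlgebra.ι ℂ TaftDoubleGen.K))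
  | K_F : TaftDoubleRel d ζ
      (FreeAlgebra.ι ℂ TaftDoubleGen.K * FreeAlgebra.ι ℂ TaftDoubleGen.F)
      (ζ⁻¹ • (FreeAlgebra.ι ℂ TaftDoubleGen.F * FreeAlgebra.ι ℂ TaftDoubleGen.K))
  | E_F : TaftDoubleRel d ζ
      (FreeAlgebra.ι ℂ TaftDoubleGen.E * FreeAlgebra.ι ℂ TaftDoubleGen.F -
        FreeAlgebra.ι ℂ TaftDoubleGen.F * FreeAlgebra.ι ℂ TaftDoubleGen.E)
      (FreeAlgebra.ι ℂ TaftDoubleGen.K -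
        FreeAlgebra.ι ℂ TaftDoubleGen.z * FreeAlgebra.ι ℂ TaftDoubleGen.K ^ (d - 1))

/-- The Drinfeld double `D(B)` of the Taft algebra `B`. -/
abbrev TaftDouble (d : ℕ) (ζ : ℂ) : Type := RingQuot (TaftDoubleRel d ζ)

/-- The generators of `D(B)` as elements of `D(B)`. -/
noncomputable def TaftDouble.gen (d : ℕ) (ζ : ℂ) (g : TaftDoubleGen) : TaftDouble d ζ :=
  RingQuot.mkAlgHom ℂ (TaftDoubleRel d ζ) (FreeAlgebra.ι ℂ g)

/-- The canonical algebra map `B → D(B)`, `K ↦ K`, `E ↦ E`. -/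
noncomputable def TaftAlg.toDouble (d : ℕ) (ζ : ℂ) : TaftAlg d ζ →ₐ[ℂ] TaftDouble d ζ :=
  RingQuot.liftAlgHom ℂ ⟨FreeAlgebra.lift ℂ (fun g => match g with
    | TaftGen.K => TaftDouble.gen d ζ TaftDoubleGen.K
    | TaftGen.E => TaftDouble.gen d ζ TaftDoubleGen.E), by
    intro x y h
    cases h with
    | K_pow =>
      simpa [TaftDouble.gen] using
        RingQuot.mkAlgHom_rel ℂ (TaftDoubleRel.K_pow (d := d) (ζ := ζ))
    | E_pow =>
      simpa [TaftDouble.gen] using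
        RingQuot.mkAlgHom_rel ℂ (TaftDoubleRel.E_pow (d := d) (ζ := ζ))
    | K_E =>
      simpa [TaftDouble.gen] using
        RingQuot.mkAlgHom_rel ℂ (TaftDoubleRel.K_E (d := d) (ζ := ζ))⟩

/-! ### Finite-dimensional modules and the stable category -/

section Stable

variable (k A : Type) [Field k] [Ring A] [Algebra k A]

/-- The left `A`-modules of finite dimension over `k`. -/
def isFinDim : ObjectProperty (ModuleCat.{0} A) := fun M =>
  Module.Finite k ((ModuleCat.restrictScalars (algebraMap k A)).obj M)

/-- The category `A-mod` of finite-dimensional left `A`-modules. -/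
abbrev FDMod := (isFinDim k A).FullSubcategory

/-- The finite-dimensional modules that are projective over `A`. -/
def FDMod.proj : ObjectProperty (FDMod k A) := fun M => Module.Projective A M.obj

/-- Two morphisms are identified if their difference factors through a projective module. -/
def stableRel : HomRel (FDMod k A) := fun X Y f g =>
  ∃ (P : FDMod k A) (_ : FDMod.proj k A P) (a : X ⟶ P) (b : P ⟶ Y), f - g = a ≫ b

variable {k A} in
/-- The direct sum of two finite-dimensional modules. -/
def FDMod.prod (P Q : FDMod k A) : FDMod k A :=
  ⟨ModuleCat.of A (P.obj × Q.obj), by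
    have hP : Module.Finite k ((ModuleCat.restrictScalars (algebraMap k A)).obj P.obj) :=
      P.property
    have hQ : Module.Finite k ((ModuleCat.restrictScalars (algebraMap k A)).obj Q.obj) :=
      Q.property
    exact inferInstanceAs (Module.Finite k
      (((ModuleCat.restrictScalars (algebraMap k A)).obj P.obj) ×
        ((ModuleCat.restrictScalars (algebraMap k A)).obj Q.obj)))⟩

variable {k A} in
lemma stableRel.add {X Y : FDMod k A} {f₁ f₂ g₁ g₂ : X ⟶ Y}
    (hf : stableRel k A f₁ f₂) (hg : stableRel k A g₁ g₂) :
    stableRel k A (f₁ + g₁) (f₂ + g₂) := by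
  obtain ⟨P, hP, a, b, h⟩ := hf
  obtain ⟨Q, hQ, a', b', h'⟩ := hg
  have hP' : Module.Projective A P.obj := hP
  have hQ' : Module.Projective A Q.obj := hQ
  refine ⟨P.prod Q, inferInstanceAs (Module.Projective A (P.obj × Q.obj)),
    ObjectProperty.homMk (ModuleCat.ofHom (LinearMap.prod a.hom.hom a'.hom.hom)),
    ObjectProperty.homMk (ModuleCat.ofHom (LinearMap.coprod b.hom.hom b'.hom.hom)), ?_⟩
  rw [add_sub_add_comm, h, h']
  rfl

instance : Congruence (stableRel k A) where
  equivalence {X Y} :=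
    { refl := fun f => ⟨⟨ModuleCat.of A PUnit.{1},
          inferInstanceAs (Module.Finite k PUnit.{1})⟩,
        inferInstanceAs (Module.Projective A PUnit.{1}), 0, 0, by simp⟩
      symm := by
        rintro f g ⟨P, hP, a, b, h⟩
        exact ⟨P, hP, -a, b, by rw [Preadditive.neg_comp, ← h, neg_sub]⟩
      trans := by
        intro f g h hfg hgh
        have := hfg.add hgh
        obtain ⟨P, hP, a, b, e⟩ := this
        exact ⟨P, hP, a, b, by rw [← e]; abel⟩ }
  comp_left f g g' := by
    rintro ⟨P, hP, a, b, h⟩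
    exact ⟨P, hP, f ≫ a, b, by rw [← Preadditive.comp_sub, h, Category.assoc]⟩
  comp_right g := by
    rintro ⟨P, hP, a, b, h⟩
    exact ⟨P, hP, a, b ≫ g, by rw [← Preadditive.sub_comp, h, Category.assoc]⟩

/-- The stable category `A-stab`: the additive quotient of `A-mod` by the projective modules. -/
abbrev StableCat := CategoryTheory.Quotient (stableRel k A)

/-- The canonical functor `A-mod ⥤ A-stab`. -/
abbrev toStable : FDMod k A ⥤ StableCat k A := CategoryTheory.Quotient.functor (stableRel k A)

instance : Preadditive (StableCat k A) :=
  CategoryTheory.Quotient.preadditive (stableRel k A) (fun _ _ _ _ _ _ hf hg => hf.add hg)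

instance : (toStable k A).Additive :=
  CategoryTheory.Quotient.functor_additive (stableRel k A) (fun _ _ _ _ _ _ hf hg => hf.add hg)

instance : HasZeroObject (StableCat k A) := by
  have hz : IsZero (⟨ModuleCat.of A PUnit.{1},
      inferInstanceAs (Module.Finite k PUnit.{1})⟩ : FDMod k A) := by
    rw [IsZero.iff_id_eq_zero]
    rfl
  exact ⟨_, (toStable k A).map_isZero hz⟩

variable {k A} in
/-- `0 → X₁ → X₂ → X₃ → 0` is a short exact sequence of modules. -/
def FDMod.IsShortExact (S : ShortComplex (FDMod k A)) : Prop :=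
  Function.Injective S.f.hom.hom ∧ Function.Exact S.f.hom.hom S.g.hom.hom ∧
    Function.Surjective S.g.hom.hom

/-- The standard triangulated structure on the stable category of a finite-dimensional selfinjective
algebra `A`: short exact sequences `0 → X₁ → X₂ → X₃ → 0` of finite-dimensional modules have natural
connecting morphisms `X₃ ⟶ X₁⟦1⟧` in `A-stab`, and the distinguished triangles are the triangles
isomorphic to the resulting `X₁ ⟶ X₂ ⟶ X₃ ⟶ X₁⟦1⟧`.

If `X₂` is projective (equivalently, injective), the connecting morphism is thus an isomorphism: the
shift is the cosyzygy functor `X₁ ↦ X₂ / X₁`, and its inverse is the syzygy functor. This determines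
the connecting morphisms of all other sequences by naturality, and so the triangulated structure is
unique up to a canonical isomorphism. -/
class StableTriangulation where
  hasShift : HasShift (StableCat k A) ℤ
  shift_additive : ∀ n : ℤ, (shiftFunctor (StableCat k A) n).Additive
  pretriangulated : Pretriangulated (StableCat k A)
  isTriangulated : IsTriangulated (StableCat k A)
  connecting (S : ShortComplex (FDMod k A)) (hS : FDMod.IsShortExact S) :
    (toStable k A).obj S.X₃ ⟶ ((toStable k A).obj S.X₁)⟦(1 : ℤ)⟧
  connecting_naturality {S S' : ShortComplex (FDMod k A)} (hS : FDMod.IsShortExact S)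
    (hS' : FDMod.IsShortExact S') (φ : S ⟶ S') :
    (toStable k A).map φ.τ₃ ≫ connecting S' hS' =
      connecting S hS ≫ ((toStable k A).map φ.τ₁)⟦(1 : ℤ)⟧'
  distinguished_iff (T : Triangle (StableCat k A)) :
    T ∈ distTriang (StableCat k A) ↔
      ∃ (S : ShortComplex (FDMod k A)) (hS : FDMod.IsShortExact S),
        Nonempty (T ≅ Triangle.mk ((toStable k A).map S.f) ((toStable k A).map S.g)
          (connecting S hS))

attribute [reducible] StableTriangulation.hasShift StableTriangulation.pretriangulated

attribute [instance] StableTriangulation.hasShift StableTriangulation.shift_additive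
  StableTriangulation.pretriangulated StableTriangulation.isTriangulated

end Stable

/-! ### Modules that are projective over `B` -/

/-- `D(B)-proj_B`: the finite-dimensional `D(B)`-modules whose restriction to `B` is projective. -/
noncomputable def projOverTaft (d : ℕ) (ζ : ℂ) : ObjectProperty (FDMod ℂ (TaftDouble d ζ)) := fun M =>
  Module.Projective (TaftAlg d ζ)
    ((ModuleCat.restrictScalars (TaftAlg.toDouble d ζ).toRingHom).obj M.obj)

/-- The full subcategory of `D(B)-stab` whose objects are the images of the objects of
`D(B)-proj_B`. -/
abbrev stableProjOverTaft (d : ℕ) (ζ : ℂ) : ObjectProperty (StableCat ℂ (TaftDouble d ζ)) :=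
  (projOverTaft d ζ).strictMap (toStable ℂ (TaftDouble d ζ))

/-- `D(B)-stab_B`: the (Verdier) quotient of the triangulated category `D(B)-stab` by the image of
`D(B)-proj_B`, that is, the localization of `D(B)-stab` at the morphisms with a cone in this
image. -/
abbrev StableOverTaft (d : ℕ) (ζ : ℂ) [StableTriangulation ℂ (TaftDouble d ζ)] :=
  (stableProjOverTaft d ζ).trW.Localization

/-- The quotient functor `D(B)-stab ⥤ D(B)-stab_B`. -/
abbrev toStableOverTaft (d : ℕ) (ζ : ℂ) [StableTriangulation ℂ (TaftDouble d ζ)] :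
    StableCat ℂ (TaftDouble d ζ) ⥤ StableOverTaft d ζ :=
  (stableProjOverTaft d ζ).trW.Q

-- The proof has two independent halves: the stable category is triangulated, and the modules
-- projective over `B` are closed under the required operations.
--
-- Triangulation. It suffices that finite-dimensional projective `A`-modules are injective and that
-- every finite-dimensional module embeds in one and is covered by one (`FrobeniusModules`). Form
-- the Verdier quotient of the derived category of all `A`-modules by the bounded complexes of
-- finite-dimensional projectives. Modules placed in degree 0 give a functor from the stable
-- category to this quotient, and it is fully faithful. The reason is that those complexes are
-- K-injective and K-projective, so morphisms between them and modules are honest chain maps. A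
-- morphism of modules killed in the quotient factors through such a complex, hence through its
-- degree 0 term (`exists_fac_of_fac_perfect`). A fraction between modules can be replaced by one
-- whose denominator has its cone in degrees `≤ -1`, where no module maps nontrivially
-- (`exists_fac_shift_single`, `trW_Q_map_surjective`). The essential image is stable under shifts,
-- by syzygies and cosyzygies, and under cones, because every stable morphism is represented by an
-- injection. The triangulation therefore pulls back.
--
-- The Frobenius property. An algebra with a linear form whose kernel contains no nonzero left ideal
-- satisfies the hypothesis (`IsFrobeniusForm.frobeniusModules`). For `D(B)` an explicit action on
-- functions of four exponents proves that the ordered monomials are linearly independent; the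
-- coefficient of `E ^ (d - 1) * F ^ (d - 1)` is then such a form, and the coefficient of `E ^ (d -
-- 1)` serves for `B`. The same basis shows that `D(B)` is free over `B`, so projective
-- `D(B)`-modules are projective over `B`.
--
-- Closure. In a short exact sequence, projectivity over `B` of two terms gives the third: a
-- projective quotient splits off, and so does a projective finite-dimensional submodule, being
-- injective over `B`. This yields shifts and extensions for any triangulation as specified. A
-- stable retract of `N` is an actual direct summand of `N ⊕ Q` with `Q` projective
-- (`projOverTaft_of_retract`).

universe w v u v₁ v₂ u₁ u₂

/-! ### Brute truncation of cochain complexes -/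

namespace CochainComplex

open ComplexShape HomologicalComplex

variable {C : Type u} [Category.{v} C] [Abelian C]

/-- The brute truncation of a cochain complex in degrees `≤ n`. -/
noncomputable abbrev bruteLE (K : CochainComplex C ℤ) (n : ℤ) : CochainComplex C ℤ :=
  (K.restriction (embeddingUpIntLE n)).extend (embeddingUpIntLE n)

/-- Only differentials entering the truncation range from outside could obstruct the lift, and
differentials raise the degree. -/
lemma embeddingUpIntLE_hasLift {K : CochainComplex C ℤ} {n : ℤ} {L : ChainComplex C ℕ}
    (φ : K.restriction (embeddingUpIntLE n) ⟶ L) : (embeddingUpIntLE n).HasLift φ := by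
  intro j hj
  exact hj.false_of_isTruncLE.elim

/-- The projection onto the brute truncation. -/
noncomputable def πBruteLE (K : CochainComplex C ℤ) (n : ℤ) : K ⟶ K.bruteLE n :=
  (embeddingUpIntLE n).liftExtend (𝟙 _) (embeddingUpIntLE_hasLift _)

lemma πBruteLE_naturality {K L : CochainComplex C ℤ} (φ : K ⟶ L) (n : ℤ) :
    φ ≫ L.πBruteLE n = K.πBruteLE n ≫ extendMap (restrictionMap φ _) (embeddingUpIntLE n) := by
  apply ((embeddingUpIntLE n).homEquiv K (L.restriction (embeddingUpIntLE n))).injective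
  ext1
  change (embeddingUpIntLE n).homRestrict (φ ≫ (embeddingUpIntLE n).liftExtend _ _) =
    (embeddingUpIntLE n).homRestrict ((embeddingUpIntLE n).liftExtend _ _ ≫ _)
  rw [Embedding.homRestrict_precomp, Embedding.homRestrict_comp_extendMap]
  simp

lemma isIso_πBruteLE (L : CochainComplex C ℤ) (n : ℤ) [L.IsStrictlyLE n] :
    IsIso (L.πBruteLE n) := by
  have : ∀ i, IsIso ((L.πBruteLE n).f i) := by
    intro i
    by_cases hi : ∃ j, (embeddingUpIntLE n).f j = i
    · obtain ⟨j, hj⟩ := hi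
      rw [πBruteLE, Embedding.isIso_liftExtend_f_iff _ _ _ hj]
      exact inferInstanceAs (IsIso (𝟙 _))
    · have h₁ : IsZero (L.X i) := L.isZero_X_of_isStrictlySupported (embeddingUpIntLE n) i
        (by simpa using hi)
      have h₂ : IsZero ((L.bruteLE n).X i) := L.isZero_stupidTrunc_X _ _ (by simpa using hi)
      exact h₁.isIso h₂ _
  exact HomologicalComplex.Hom.isIso_of_components _

/-- Truncation is natural and changes nothing on a target already in degrees `≤ n`. -/
lemma exists_fac_πBruteLE {K L : CochainComplex C ℤ} (φ : K ⟶ L) (n : ℤ) [L.IsStrictlyLE n] :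
    ∃ φ' : K.bruteLE n ⟶ L, φ = K.πBruteLE n ≫ φ' := by
  have := L.isIso_πBruteLE n
  exact ⟨extendMap (restrictionMap φ _) _ ≫ inv (L.πBruteLE n), by
    rw [← Category.assoc, ← πBruteLE_naturality, Category.assoc, IsIso.hom_inv_id,
      Category.comp_id]⟩

end CochainComplex

/-! ### Bounded complexes with terms in a class of projective and injective objects -/

namespace CochainComplex

variable {C : Type u} [Category.{v} C] [Abelian C]

/-- The complexes whose terms satisfy `P`, almost all of them zero. -/
structure IsBoundedIn (P : ObjectProperty C) (K : CochainComplex C ℤ) : Prop where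
  prop (i : ℤ) : P (K.X i)
  ge : ∃ a, K.IsStrictlyGE a
  le : ∃ b, K.IsStrictlyLE b

namespace IsBoundedIn

variable {P : ObjectProperty C} {K L : CochainComplex C ℤ}

lemma isKInjective (h : K.IsBoundedIn P) (hP : ∀ X, P X → Injective X) : K.IsKInjective := by
  obtain ⟨a, _⟩ := h.ge
  have := fun i ↦ hP _ (h.prop i)
  exact isKInjective_of_injective K a

lemma isKProjective (h : K.IsBoundedIn P) (hP : ∀ X, P X → Projective X) : K.IsKProjective := by
  obtain ⟨a, _⟩ := h.le
  have := fun i ↦ hP _ (h.prop i)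
  exact isKProjective_of_projective K a

lemma shift (h : K.IsBoundedIn P) (n : ℤ) : (K⟦n⟧).IsBoundedIn P where
  prop i := h.prop _
  ge := by
    obtain ⟨a, _⟩ := h.ge
    exact ⟨a - n, K.isStrictlyGE_shift a n _ (by lia)⟩
  le := by
    obtain ⟨a, _⟩ := h.le
    exact ⟨a - n, K.isStrictlyLE_shift a n _ (by lia)⟩

lemma mappingCone [P.IsClosedUnderBinaryProducts] [P.IsClosedUnderIsomorphisms]
    (hK : K.IsBoundedIn P) (hL : L.IsBoundedIn P) (φ : K ⟶ L) :
    (CochainComplex.mappingCone φ).IsBoundedIn P where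
  prop i := by
    refine P.prop_of_iso (HomologicalComplex.homotopyCofiber.XIsoBiprod φ i (i + 1) rfl).symm ?_
    exact P.prop_of_iso (biprod.isoProd _ _).symm (P.prop_prod _ _ (hK.prop _) (hL.prop _))
  ge := by
    obtain ⟨a, _⟩ := hK.ge
    obtain ⟨b, _⟩ := hL.ge
    exact ⟨min (a - 1) b, isStrictlyGE_mappingCone φ a b _ (by simp) (by simp)⟩
  le := by
    obtain ⟨a, _⟩ := hK.le
    obtain ⟨b, _⟩ := hL.le
    refine ⟨max a b, ?_⟩
    rw [isStrictlyLE_iff]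
    intro i hi
    simp only [mappingCone.isZero_X_iff]
    exact ⟨K.isZero_of_isStrictlyLE a _, L.isZero_of_isStrictlyLE b _⟩

lemma bruteLE [P.ContainsZero] [P.IsClosedUnderIsomorphisms] (h : K.IsBoundedIn P) (n : ℤ) :
    (K.bruteLE n).IsBoundedIn P where
  prop i := by
    by_cases hi : ∃ j, (ComplexShape.embeddingUpIntLE n).f j = i
    · obtain ⟨j, hj⟩ := hi
      exact P.prop_of_iso (K.stupidTruncXIso _ hj).symm (h.prop i)
    · exact P.prop_of_isZero (K.isZero_stupidTrunc_X _ _ (by simpa using hi))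
  ge := by
    obtain ⟨a, ha⟩ := h.ge
    exact ⟨a, inferInstanceAs (CochainComplex.IsStrictlyGE
      (HomologicalComplex.stupidTrunc K (ComplexShape.embeddingUpIntLE n)) a)⟩
  le := ⟨n, inferInstance⟩

lemma single [P.ContainsZero] [P.IsClosedUnderIsomorphisms] {X : C} (h : P X) (n : ℤ) :
    ((singleFunctor C n).obj X).IsBoundedIn P where
  prop i := by
    by_cases hi : i = n
    · subst hi
      exact P.prop_of_iso (HomologicalComplex.singleObjXSelf _ _ _).symm h
    · exact P.prop_of_isZero (HomologicalComplex.isZero_single_obj_X _ _ _ _ hi)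
  ge := ⟨n, inferInstance⟩
  le := ⟨n, inferInstance⟩

end IsBoundedIn

lemma IsKInjective.Q_map_surjective [HasDerivedCategory.{w} C] (K L : CochainComplex C ℤ)
    [L.IsKInjective] : Function.Surjective
      (DerivedCategory.Q.map : (K ⟶ L) → (DerivedCategory.Q.obj K ⟶ DerivedCategory.Q.obj L)) := by
  intro f
  obtain ⟨g, hg⟩ := (IsKInjective.Qh_map_bijective ((HomotopyCategory.quotient _ _).obj K) L).2
    ((DerivedCategory.quotientCompQhIso C).hom.app K ≫ f ≫
      (DerivedCategory.quotientCompQhIso C).inv.app L)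
  obtain ⟨g, rfl⟩ := (HomotopyCategory.quotient _ _).map_surjective g
  refine ⟨g, ?_⟩
  rw [← cancel_epi ((DerivedCategory.quotientCompQhIso C).hom.app K),
    ← DerivedCategory.quotientCompQhIso_hom_naturality, hg]
  simp

lemma IsKProjective.Q_map_surjective [HasDerivedCategory.{w} C] (K L : CochainComplex C ℤ)
    [K.IsKProjective] : Function.Surjective
      (DerivedCategory.Q.map : (K ⟶ L) → (DerivedCategory.Q.obj K ⟶ DerivedCategory.Q.obj L)) := by
  intro f
  obtain ⟨g, hg⟩ := (IsKProjective.Qh_map_bijective K ((HomotopyCategory.quotient _ _).obj L)).2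
    ((DerivedCategory.quotientCompQhIso C).hom.app K ≫ f ≫
      (DerivedCategory.quotientCompQhIso C).inv.app L)
  obtain ⟨g, rfl⟩ := (HomotopyCategory.quotient _ _).map_surjective g
  refine ⟨g, ?_⟩
  rw [← cancel_epi ((DerivedCategory.quotientCompQhIso C).hom.app K),
    ← DerivedCategory.quotientCompQhIso_hom_naturality, hg]
  simp

end CochainComplex

/-! ### Morphisms in a Verdier quotient -/

namespace CategoryTheory.ObjectProperty

variable {D : Type u} [Category.{v} D] [HasZeroObject D] [HasShift D ℤ] [Preadditive D]
  [∀ n : ℤ, (shiftFunctor D n).Additive] [Pretriangulated D] [CategoryTheory.IsTriangulated D]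
  (P : ObjectProperty D) [P.IsTriangulated]

open scoped ZeroObject in
lemma isZero_trW_Q_obj {X : D} (hX : P X) : IsZero (P.trW.Q.obj X) := by
  have h : P.trW (0 : X ⟶ (0 : D)) := trW.mk' P (contractible_distinguished X) hX
  have : IsIso (P.trW.Q.map (0 : X ⟶ (0 : D))) := Localization.inverts P.trW.Q P.trW _ h
  exact (P.trW.Q.map_isZero (isZero_zero D)).of_iso
    (asIso (P.trW.Q.map (0 : X ⟶ (0 : D))))

lemma exists_fac_of_trW_Q_map_eq_zero {X Y : D} {f : X ⟶ Y} (hf : P.trW.Q.map f = 0) :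
    ∃ (Z : D) (_ : P Z) (u : X ⟶ Z) (v : Z ⟶ Y), f = u ≫ v := by
  rw [← P.trW.Q.map_zero, MorphismProperty.map_eq_iff_postcomp _ P.trW] at hf
  obtain ⟨Z, s, hs, h⟩ := hf
  rw [zero_comp] at h
  rw [trW_iff'] at hs
  obtain ⟨Z, a, b, hT, hZ⟩ := hs
  obtain ⟨q, hq⟩ := Triangle.coyoneda_exact₂ _ hT _ h
  exact ⟨Z, hZ, q, _, hq⟩

/-- Criterion for fullness: if the connecting morphism of a denominator factors through an object of
`P` that receives nothing from `X`, the denominator can be enlarged until the numerator lifts to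
`Y`. -/
lemma trW_Q_map_surjective {X Y : D}
    (h : ∀ (Z : D), P Z → ∀ f : Z ⟶ Y⟦(1 : ℤ)⟧, ∃ (V : D) (_ : P V) (p : Z ⟶ V)
      (g : V ⟶ Y⟦(1 : ℤ)⟧), f = p ≫ g ∧ ∀ q : X ⟶ V, q = 0) :
    Function.Surjective (P.trW.Q.map : (X ⟶ Y) → _) := by
  intro f
  obtain ⟨α, hα⟩ := Localization.exists_leftFraction P.trW.Q P.trW f
  obtain ⟨Z, u, v, hT, hZ⟩ := α.hs
  obtain ⟨V, hV, p, g, rfl, hV'⟩ := h Z hZ v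
  -- The new denominator `s'` has cone `V`; the morphism of triangles that is the identity on `Y`
  -- and `p` on cones shows that `s'` factors through `α.s`.
  obtain ⟨Y', s', u', hT'⟩ := distinguished_cocone_triangle₂ g
  obtain ⟨c, hc⟩ : ∃ c : α.Y' ⟶ Y', α.s ≫ c = s' := by
    obtain ⟨c, hc, -⟩ := complete_distinguished_triangle_morphism₂ _ _ hT hT' (𝟙 Y) p
      (by
        dsimp only [Triangle.mk]
        rw [Functor.map_id, Category.comp_id])
    exact ⟨c, hc.trans (Category.id_comp _)⟩
  -- The numerator composed into the cone `V` is zero, so it comes from `Y`.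
  obtain ⟨k, hk⟩ : ∃ k : X ⟶ Y, _ := Triangle.coyoneda_exact₂ _ hT' (α.f ≫ c) (hV' _)
  replace hk : α.f ≫ c = k ≫ s' := hk
  have := Localization.inverts P.trW.Q P.trW s' ⟨_, _, _, hT', hV⟩
  refine ⟨k, ?_⟩
  rw [← cancel_mono (P.trW.Q.map s'), ← Functor.map_comp, ← hk, hα, ← hc, Functor.map_comp,
    Functor.map_comp, MorphismProperty.LeftFraction.map_comp_map_s_assoc]

end CategoryTheory.ObjectProperty

/-! ### Perfect complexes and modules in the derived category -/

namespace DerivedCategory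

variable {C : Type u} [Category.{v} C] [Abelian C] [HasDerivedCategory.{w} C]

/-- The objects of the derived category that are represented by bounded complexes with terms
in `P`. -/
def perfect (P : ObjectProperty C) : ObjectProperty (DerivedCategory C) :=
  fun X ↦ ∃ K : CochainComplex C ℤ, K.IsBoundedIn P ∧ Nonempty (X ≅ Q.obj K)

variable (P : ObjectProperty C)

instance : (perfect P).IsClosedUnderIsomorphisms where
  of_iso := by
    rintro X Y e ⟨K, hK, ⟨e'⟩⟩
    exact ⟨K, hK, ⟨e.symm ≪≫ e'⟩⟩

lemma perfect_single [P.ContainsZero] [P.IsClosedUnderIsomorphisms] {X : C} (h : P X) :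
    perfect P ((singleFunctor C 0).obj X) :=
  ⟨_, .single h 0, ⟨Iso.refl _⟩⟩

lemma perfect_isTriangulated [P.ContainsZero] [P.IsClosedUnderIsomorphisms]
    [P.IsClosedUnderBinaryProducts] (hP : ∀ X, P X → Injective X) :
    (perfect P).IsTriangulated where
  exists_zero := by
    obtain ⟨Z, hZ, hPZ⟩ := P.exists_prop_of_containsZero
    exact ⟨_, (singleFunctor C 0).map_isZero hZ, perfect_single P hPZ⟩
  isStableUnderShiftBy n := ⟨by
    rintro X ⟨K, hK, ⟨e⟩⟩
    exact ⟨K⟦n⟧, hK.shift n, ⟨(shiftFunctor _ n).mapIso e ≪≫ (Q.commShiftIso n).symm.app K⟩⟩⟩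
  toIsTriangulatedClosed₂ := by
    have : (perfect P).IsStableUnderShift ℤ := ⟨fun n ↦ ⟨by
      rintro X ⟨K, hK, ⟨e⟩⟩
      exact ⟨K⟦n⟧, hK.shift n, ⟨(shiftFunctor _ n).mapIso e ≪≫ (Q.commShiftIso n).symm.app K⟩⟩⟩⟩
    have : (perfect P).IsTriangulatedClosed₃ := .mk' (by
      rintro T hT ⟨K, hK, ⟨eK⟩⟩ ⟨L, hL, ⟨eL⟩⟩
      -- K-injectivity of `L` represents the first morphism by a chain map, so its cone is a mapping
      -- cone, again bounded with terms in `P`.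
      have := hL.isKInjective hP
      obtain ⟨φ, hφ⟩ := CochainComplex.IsKInjective.Q_map_surjective K L
        (eK.inv ≫ T.mor₁ ≫ eL.hom)
      exact ⟨_, hK.mappingCone hL φ, ⟨Triangle.π₃.mapIso (isoTriangleOfIso₁₂ T _ hT
        (mappingCone_triangle_distinguished φ) eK eL (by
          change _ = eK.hom ≫ Q.map φ
          simp only [hφ, Iso.hom_inv_id_assoc]
          rfl))⟩⟩)
    exact .of_isTriangulatedClosed₃

variable {P}

/-- K-injectivity of the complex makes `a` a chain map and K-projectivity makes `b` one. Modules
embed fully faithfully in the derived category, so the factorization already holds between complexes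
and can be read in degree 0. -/
lemma exists_fac_of_fac_perfect (hinj : ∀ X, P X → Injective X) (hproj : ∀ X, P X → Projective X)
    {M N : C} {X : DerivedCategory C} (hX : perfect P X) {f : M ⟶ N}
    {a : Q.obj ((CochainComplex.singleFunctor C 0).obj M) ⟶ X}
    {b : X ⟶ Q.obj ((CochainComplex.singleFunctor C 0).obj N)}
    (h : Q.map ((CochainComplex.singleFunctor C 0).map f) = a ≫ b) :
    ∃ (Y : C) (_ : P Y) (u : M ⟶ Y) (v : Y ⟶ N), f = u ≫ v := by
  obtain ⟨K, hK, ⟨e⟩⟩ := hX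
  have := hK.isKInjective hinj
  have := hK.isKProjective hproj
  obtain ⟨α, hα⟩ := CochainComplex.IsKInjective.Q_map_surjective
    ((CochainComplex.singleFunctor C 0).obj M) K (a ≫ e.hom)
  obtain ⟨β, hβ⟩ := CochainComplex.IsKProjective.Q_map_surjective K
    ((CochainComplex.singleFunctor C 0).obj N) (e.inv ≫ b)
  obtain ⟨g, hg⟩ := (CochainComplex.singleFunctor C 0).map_surjective (α ≫ β)
  obtain rfl : f = g := by
    apply (singleFunctor C 0).map_injective
    have : Q.map ((CochainComplex.singleFunctor C 0).map f) =
        Q.map ((CochainComplex.singleFunctor C 0).map g) := by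
      rw [hg, Functor.map_comp, hα, hβ, h]
      simp
    exact this
  refine ⟨K.X 0, hK.prop 0, (HomologicalComplex.singleObjXSelf _ _ _).inv ≫ α.f 0,
    β.f 0 ≫ (HomologicalComplex.singleObjXSelf _ _ _).hom, ?_⟩
  let α₀ : ((HomologicalComplex.single C (ComplexShape.up ℤ) 0).obj M).X 0 ⟶ K.X 0 := α.f 0
  let β₀ : K.X 0 ⟶ ((HomologicalComplex.single C (ComplexShape.up ℤ) 0).obj N).X 0 := β.f 0
  have h₁ : ((HomologicalComplex.single C (ComplexShape.up ℤ) 0).map f).f 0 = α₀ ≫ β₀ :=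
    HomologicalComplex.congr_hom hg 0
  rw [HomologicalComplex.single_map_f_self] at h₁
  have h₂ := (HomologicalComplex.singleObjXSelf (ComplexShape.up ℤ) 0 M).inv ≫= h₁ =≫
    (HomologicalComplex.singleObjXSelf (ComplexShape.up ℤ) 0 N).hom
  simp only [Category.assoc, Iso.inv_hom_id_assoc, Iso.inv_hom_id, Category.comp_id] at h₂
  exact h₂.trans (Category.assoc _ _ _).symm

/-- By K-injectivity the morphism is a chain map out of degree 0, where the target vanishes. -/
lemma hom_eq_zero_of_isStrictlyLE (hinj : ∀ X, P X → Injective X)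
    {M : C} {K : CochainComplex C ℤ} (hK : K.IsBoundedIn P) [K.IsStrictlyLE (-1)]
    (f : Q.obj ((CochainComplex.singleFunctor C 0).obj M) ⟶ Q.obj K) : f = 0 := by
  have := hK.isKInjective hinj
  obtain ⟨α, rfl⟩ := CochainComplex.IsKInjective.Q_map_surjective
    ((CochainComplex.singleFunctor C 0).obj M) K f
  rw [show α = 0 from HomologicalComplex.from_single_hom_ext
    ((K.isZero_of_isStrictlyLE (-1) 0).eq_of_tgt _ _)]
  exact Functor.map_zero _ _ _

variable [P.ContainsZero] [P.IsClosedUnderIsomorphisms]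

/-- A shifted module lives in degree `-1`. A chain map into it from a bounded complex factors
through the brute truncation in degrees `≤ -1`, which still has terms in `P`. -/
lemma exists_fac_shift_single (hinj : ∀ X, P X → Injective X) (hproj : ∀ X, P X → Projective X)
    {N : C} {X : DerivedCategory C} (hX : perfect P X)
    (f : X ⟶ (Q.obj ((CochainComplex.singleFunctor C 0).obj N))⟦(1 : ℤ)⟧) :
    ∃ (V : DerivedCategory C) (_ : perfect P V) (p : X ⟶ V)
      (g : V ⟶ (Q.obj ((CochainComplex.singleFunctor C 0).obj N))⟦(1 : ℤ)⟧), f = p ≫ g ∧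
      ∀ (M : C) (q : Q.obj ((CochainComplex.singleFunctor C 0).obj M) ⟶ V), q = 0 := by
  obtain ⟨K, hK, ⟨e⟩⟩ := hX
  have := hK.isKProjective hproj
  let e' := (Q.commShiftIso (1 : ℤ)).app ((CochainComplex.singleFunctor C 0).obj N)
  obtain ⟨φ, hφ⟩ := CochainComplex.IsKProjective.Q_map_surjective K
    (((CochainComplex.singleFunctor C 0).obj N)⟦(1 : ℤ)⟧) (e.inv ≫ f ≫ e'.inv)
  have : (((CochainComplex.singleFunctor C 0).obj N)⟦(1 : ℤ)⟧).IsStrictlyLE (-1) :=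
    CochainComplex.isStrictlyLE_shift _ 0 1 (-1) (by lia)
  obtain ⟨ψ, rfl⟩ := CochainComplex.exists_fac_πBruteLE φ (-1)
  rw [Functor.map_comp] at hφ
  refine ⟨_, ⟨_, hK.bruteLE (-1), ⟨Iso.refl _⟩⟩, e.hom ≫ Q.map (K.πBruteLE (-1)),
    Q.map ψ ≫ e'.hom, ?_,
    fun M q ↦ hom_eq_zero_of_isStrictlyLE hinj (hK.bruteLE (-1)) q⟩
  have h := e.hom ≫= hφ =≫ e'.hom
  simp only [Category.assoc, Iso.hom_inv_id_assoc, Iso.inv_hom_id] at h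
  rw [Category.assoc]
  exact (h.trans (Category.comp_id f)).symm

lemma full_singleFunctor_comp_Q (hinj : ∀ X, P X → Injective X)
    (hproj : ∀ X, P X → Projective X) [(perfect P).IsTriangulated] :
    (singleFunctor C 0 ⋙ (perfect P).trW.Q).Full where
  map_surjective {M N} f := by
    obtain ⟨α, hα⟩ := (perfect P).trW_Q_map_surjective
      (X := (singleFunctor C 0).obj M) (Y := (singleFunctor C 0).obj N) (fun Z hZ v ↦ by
        obtain ⟨V, hV, p, g, h, hV'⟩ := exists_fac_shift_single hinj hproj hZ v
        exact ⟨V, hV, p, g, h, hV' M⟩) f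
    obtain ⟨k, rfl⟩ := (singleFunctor C 0).map_surjective α
    exact ⟨k, hα⟩

omit [P.ContainsZero] [P.IsClosedUnderIsomorphisms] in
lemma exists_fac_of_Q_map_eq_zero (hinj : ∀ X, P X → Injective X)
    (hproj : ∀ X, P X → Projective X) [(perfect P).IsTriangulated] {M N : C} {f : M ⟶ N}
    (hf : (perfect P).trW.Q.map ((singleFunctor C 0).map f) = 0) :
    ∃ (Y : C) (_ : P Y) (u : M ⟶ Y) (v : Y ⟶ N), f = u ≫ v := by
  obtain ⟨X, hX, u, v, h⟩ := (perfect P).exists_fac_of_trW_Q_map_eq_zero hf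
  exact exists_fac_of_fac_perfect hinj hproj hX h

end DerivedCategory

namespace CategoryTheory

/-! ### Transport of shifts and triangulations along fully faithful functors -/

lemma ObjectProperty.isStableUnderShift_int {T : Type u₂} [Category.{v₂} T] [HasShift T ℤ]
    (P : ObjectProperty T) [P.IsClosedUnderIsomorphisms]
    (h₁ : ∀ X, P X → P (X⟦(1 : ℤ)⟧)) (h₂ : ∀ X, P X → P (X⟦(-1 : ℤ)⟧)) :
    P.IsStableUnderShift ℤ where
  isStableUnderShiftBy n := ⟨fun X hX ↦ by
    rw [ObjectProperty.prop_shift_iff]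
    induction n using Int.induction_on with
    | zero => exact P.prop_of_iso ((shiftFunctorZero T ℤ).symm.app X) hX
    | succ n h => exact P.prop_of_iso ((shiftFunctorAdd T (n : ℤ) 1).symm.app X) (h₁ _ h)
    | pred n h => exact P.prop_of_iso ((shiftFunctorAdd' T (-n : ℤ) (-1) (-n - 1)
        (by lia)).symm.app X) (h₂ _ h)⟩

namespace Functor

variable {S : Type u₁} [Category.{v₁} S] {T : Type u₂} [Category.{v₂} T] [HasShift T ℤ]
  (G : S ⥤ T) [G.Full] [G.Faithful]

section

variable [G.essImage.IsStableUnderShift ℤ]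

/-- The shift functors on a full subcategory whose essential image is stable under shifts. -/
noncomputable def liftShiftFunctor (n : ℤ) : S ⥤ S :=
  essImage.liftFunctor (G ⋙ shiftFunctor T n) G
    (fun X ↦ G.essImage.le_shift n _ (G.obj_mem_essImage X))

/-- The functors `liftShiftFunctor` lift the shift functors. -/
noncomputable def liftShiftFunctorIso (n : ℤ) :
    G.liftShiftFunctor n ⋙ G ≅ G ⋙ shiftFunctor T n :=
  essImage.liftFunctorCompIso _ _ _

end

variable [HasShift S ℤ] [G.CommShift ℤ] [Preadditive S] [HasZeroObject S]
  [∀ n : ℤ, (shiftFunctor S n).Additive] [Preadditive T] [HasZeroObject T]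
  [∀ n : ℤ, (shiftFunctor T n).Additive] [Pretriangulated T] [G.Additive]

/-- The pretriangulated structure on a full subcategory that is closed under cones. -/
@[reducible]
noncomputable def liftPretriangulated
    (hG : ∀ {X Y : S} (f : X ⟶ Y), ∃ (Z : S) (g : G.obj Y ⟶ G.obj Z)
      (h : G.obj Z ⟶ (G.obj X)⟦(1 : ℤ)⟧), Triangle.mk (G.map f) g h ∈ distTriang T) :
    Pretriangulated S where
  distinguishedTriangles := G.mapTriangle.obj ⁻¹' (distTriang T)
  isomorphic_distinguished T₁ hT₁ T₂ e :=
    isomorphic_distinguished _ hT₁ _ (G.mapTriangle.mapIso e)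
  contractible_distinguished X := by
    refine (Triangle.distinguished_iff_of_isZero₃ _ (G.map_isZero (isZero_zero S))).2 ?_
    change IsIso (G.map (𝟙 X))
    infer_instance
  distinguished_cocone_triangle {X Y} f := by
    obtain ⟨Z, g, h, mem⟩ := hG f
    refine ⟨Z, G.preimage g, G.preimage (h ≫ (G.commShiftIso (1 : ℤ)).inv.app X), ?_⟩
    change Triangle.mk (G.map f) (G.map (G.preimage g))
      (G.map (G.preimage (h ≫ (G.commShiftIso (1 : ℤ)).inv.app X)) ≫
        (G.commShiftIso (1 : ℤ)).hom.app X) ∈ distTriang T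
    rw [G.map_preimage, G.map_preimage, Category.assoc, Iso.inv_hom_id_app]
    exact (Category.comp_id h).symm ▸ mem
  rotate_distinguished_triangle T :=
    (rotate_distinguished_triangle (G.mapTriangle.obj T)).trans
      (distinguished_iff_of_iso (G.mapTriangleRotateIso.app T))
  complete_distinguished_triangle_morphism T₁ T₂ hT₁ hT₂ a b comm := by
    let φ := completeDistinguishedTriangleMorphism _ _ hT₁ hT₂ (G.map a) (G.map b)
      (by
        change G.map _ ≫ G.map _ = G.map _ ≫ G.map _
        rw [← Functor.map_comp, comm, Functor.map_comp])
    obtain ⟨ψ, hψ⟩ := G.mapTriangle.map_surjective φ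
    have h₁ : ψ.hom₁ = a := G.map_injective (congr_arg (·.hom₁) hψ)
    have h₂ : ψ.hom₂ = b := G.map_injective (congr_arg (·.hom₂) hψ)
    exact ⟨ψ.hom₃, by rw [← h₂, ψ.comm₂], by rw [← h₁, ψ.comm₃]⟩

end Functor

end CategoryTheory

/-! ### The stable category of a Frobenius algebra is triangulated -/

section FrobeniusModules

variable (k A : Type) [Field k] [Ring A] [Algebra k A]

/-- The finite-dimensional projective modules are injective, and every finite-dimensional module
is a submodule and a quotient of a finite-dimensional projective module. -/
class FrobeniusModules : Prop where
  injective (P : FDMod k A) : FDMod.proj k A P → Injective P.obj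
  exists_injective (M : FDMod k A) : ∃ (P : FDMod k A) (_ : FDMod.proj k A P) (f : M ⟶ P),
    Function.Injective f.hom.hom
  exists_surjective (M : FDMod k A) : ∃ (P : FDMod k A) (_ : FDMod.proj k A P) (f : P ⟶ M),
    Function.Surjective f.hom.hom

variable {k A}

lemma isFinDim_of_surjective {M N : ModuleCat.{0} A} (f : M ⟶ N) (hf : Function.Surjective f.hom)
    (hM : isFinDim k A M) : isFinDim k A N := by
  have : Module.Finite k ((ModuleCat.restrictScalars (algebraMap k A)).obj M) := hM
  exact Module.Finite.of_surjective ((ModuleCat.restrictScalars (algebraMap k A)).map f).hom hf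

lemma isFinDim_of_injective {M N : ModuleCat.{0} A} (f : M ⟶ N) (hf : Function.Injective f.hom)
    (hN : isFinDim k A N) : isFinDim k A M := by
  have : Module.Finite k ((ModuleCat.restrictScalars (algebraMap k A)).obj N) := hN
  exact Module.Finite.of_injective ((ModuleCat.restrictScalars (algebraMap k A)).map f).hom hf

namespace FDMod

lemma exists_cokernel {M N : FDMod k A} (f : M ⟶ N) (hf : Function.Injective f.hom.hom) :
    ∃ (L : FDMod k A) (g : N ⟶ L) (w : f ≫ g = 0), IsShortExact (ShortComplex.mk f g w) := by
  let R := LinearMap.range f.hom.hom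
  let L : FDMod k A := ⟨ModuleCat.of A (N.obj ⧸ R),
    isFinDim_of_surjective (ModuleCat.ofHom R.mkQ) R.mkQ_surjective N.property⟩
  refine ⟨L, ObjectProperty.homMk (ModuleCat.ofHom R.mkQ), ?_, hf, ?_, R.mkQ_surjective⟩
  · ext x
    exact (Submodule.Quotient.mk_eq_zero R).2 ⟨x, rfl⟩
  · intro x
    exact (Submodule.Quotient.mk_eq_zero R)

lemma exists_kernel {N L : FDMod k A} (g : N ⟶ L) (hg : Function.Surjective g.hom.hom) :
    ∃ (M : FDMod k A) (f : M ⟶ N) (w : f ≫ g = 0), IsShortExact (ShortComplex.mk f g w) := by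
  let R := LinearMap.ker g.hom.hom
  let M : FDMod k A := ⟨ModuleCat.of A R,
    isFinDim_of_injective (ModuleCat.ofHom R.subtype) R.injective_subtype N.property⟩
  refine ⟨M, ObjectProperty.homMk (ModuleCat.ofHom R.subtype), ?_, R.injective_subtype, ?_, hg⟩
  · ext x
    exact x.2
  · intro x
    exact ⟨fun h ↦ ⟨⟨x, h⟩, rfl⟩, by rintro ⟨y, rfl⟩; exact y.2⟩

lemma IsShortExact.shortExact {S : ShortComplex (FDMod k A)} (hS : IsShortExact S) :
    (S.map (isFinDim k A).ι).ShortExact :=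
  ModuleCat.shortComplex_shortExact _ hS.2.1 hS.1 hS.2.2

lemma toStable_map_eq_iff {M N : FDMod k A} (f g : M ⟶ N) :
    (toStable k A).map f = (toStable k A).map g ↔ stableRel k A f g :=
  CategoryTheory.Quotient.functor_map_eq_iff _ _ _

lemma isZero_toStable {P : FDMod k A} (hP : proj k A P) : IsZero ((toStable k A).obj P) := by
  rw [IsZero.iff_id_eq_zero, ← CategoryTheory.Functor.map_id, ← (toStable k A).map_zero,
    toStable_map_eq_iff]
  exact ⟨P, hP, 𝟙 _, 𝟙 _, by simp⟩

/-- A direct summand that is projective can be neglected in the stable category. -/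
noncomputable def toStableProdIso (M : FDMod k A) {P : FDMod k A} (hP : proj k A P) :
    (toStable k A).obj (M.prod P) ≅ (toStable k A).obj M where
  hom := (toStable k A).map (ObjectProperty.homMk (ModuleCat.ofHom (LinearMap.fst A M.obj P.obj)))
  inv := (toStable k A).map (ObjectProperty.homMk (ModuleCat.ofHom (LinearMap.inl A M.obj P.obj)))
  hom_inv_id := by
    rw [← Functor.map_comp, ← CategoryTheory.Functor.map_id, toStable_map_eq_iff]
    refine ⟨P, hP, -ObjectProperty.homMk (ModuleCat.ofHom (LinearMap.snd A M.obj P.obj)),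
      ObjectProperty.homMk (ModuleCat.ofHom (LinearMap.inr A M.obj P.obj)), ?_⟩
    ext x
    refine Prod.ext ?_ ?_
    · change x.1 - x.1 = 0
      exact sub_self _
    · change 0 - x.2 = -x.2
      exact zero_sub _
  inv_hom_id := by
    rw [← Functor.map_comp, ← CategoryTheory.Functor.map_id]
    rfl

/-- Every morphism of the stable category is represented by a monomorphism. -/
lemma exists_shortExact [FrobeniusModules k A] {M N : FDMod k A} (f : M ⟶ N) :
    ∃ (P : FDMod k A) (hP : proj k A P) (L : FDMod k A) (i : M ⟶ N.prod P) (g : N.prod P ⟶ L)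
      (w : i ≫ g = 0), IsShortExact (ShortComplex.mk i g w) ∧
      (toStable k A).map i ≫ (toStableProdIso N hP).hom = (toStable k A).map f := by
  obtain ⟨P, hP, j, hj⟩ := FrobeniusModules.exists_injective M
  let i : M ⟶ N.prod P :=
    ObjectProperty.homMk (ModuleCat.ofHom (LinearMap.prod f.hom.hom j.hom.hom))
  obtain ⟨L, g, w, h⟩ := exists_cokernel i (fun x y hxy ↦ hj (congr_arg Prod.snd hxy))
  refine ⟨P, hP, L, i, g, w, h, ?_⟩
  change (toStable k A).map _ ≫ (toStable k A).map _ = _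
  rw [← Functor.map_comp]
  rfl

end FDMod

variable (k A)

/-- The finite-dimensional projective modules, among all modules. -/
def finProj : ObjectProperty (ModuleCat.{0} A) :=
  fun M ↦ isFinDim k A M ∧ Module.Projective A M

instance : (finProj k A).ContainsZero where
  exists_zero := ⟨ModuleCat.of A PUnit.{1}, ModuleCat.isZero_of_subsingleton _,
    inferInstanceAs (Module.Finite k PUnit.{1}), inferInstanceAs (Module.Projective A PUnit.{1})⟩

instance : (finProj k A).IsClosedUnderIsomorphisms where
  of_iso {M N} e h := by
    have := h.2
    exact ⟨isFinDim_of_surjective e.hom e.toLinearEquiv.surjective h.1,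
      Module.Projective.of_equiv e.toLinearEquiv⟩

instance : (finProj k A).IsClosedUnderBinaryProducts where
  limitsOfShape_le := by
    rintro X ⟨p⟩
    have h₁ := p.prop_diag_obj (.mk .left)
    have h₂ := p.prop_diag_obj (.mk .right)
    have := h₁.2
    have := h₂.2
    have h : finProj k A (ModuleCat.of A (p.diag.obj (.mk .left) × p.diag.obj (.mk .right))) :=
      ⟨(FDMod.prod (k := k) ⟨_, h₁.1⟩ ⟨_, h₂.1⟩).property, inferInstance⟩
    refine (finProj k A).prop_of_iso ?_ h
    exact (ModuleCat.binaryProductLimitCone (p.diag.obj (.mk .left))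
      (p.diag.obj (.mk .right))).isLimit.conePointUniqueUpToIso
        ((IsLimit.postcomposeHomEquiv (diagramIsoPair p.diag) _).symm p.isLimit)

lemma finProj_projective {M : ModuleCat.{0} A} (h : finProj k A M) : Projective M :=
  (IsProjective.iff_projective (R := A) M).1 h.2

lemma finProj_injective [FrobeniusModules k A] {M : ModuleCat.{0} A} (h : finProj k A M) :
    Injective M :=
  FrobeniusModules.injective (k := k) ⟨M, h.1⟩ h.2

attribute [local instance] HasDerivedCategory.standard

/-- The objects of the derived category that are represented by bounded complexes of
finite-dimensional projective modules. -/
noncomputable abbrev finPerfect : ObjectProperty (DerivedCategory (ModuleCat.{0} A)) :=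
  DerivedCategory.perfect (finProj k A)

instance [FrobeniusModules k A] : (finPerfect k A).IsTriangulated :=
  DerivedCategory.perfect_isTriangulated _ (fun _ ↦ finProj_injective k A)

variable [FrobeniusModules k A]

/-- The Verdier quotient of the derived category by the bounded complexes of finite-dimensional
projective modules. -/
noncomputable abbrev SingularityCat := (finPerfect k A).trW.Localization

/-- The functor from finite-dimensional modules to the singularity category. -/
noncomputable abbrev toSingularity : FDMod k A ⥤ SingularityCat k A :=
  (isFinDim k A).ι ⋙ DerivedCategory.singleFunctor (ModuleCat.{0} A) 0 ⋙ (finPerfect k A).trW.Q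

instance : (toSingularity k A).Additive := inferInstance

/-- This identity of the kernels makes the functor from the stable category both well defined and
faithful. -/
lemma toSingularity_map_eq_iff {M N : FDMod k A} (f g : M ⟶ N) :
    (toSingularity k A).map f = (toSingularity k A).map g ↔ stableRel k A f g := by
  rw [← sub_eq_zero, ← Functor.map_sub]
  constructor
  · intro h
    obtain ⟨P, hP, u, v, h⟩ := DerivedCategory.exists_fac_of_Q_map_eq_zero
      (fun _ ↦ finProj_injective k A) (fun _ ↦ finProj_projective k A) h
    exact ⟨⟨P, hP.1⟩, hP.2, ObjectProperty.homMk u, ObjectProperty.homMk v, by ext1; exact h⟩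
  · rintro ⟨P, hP, u, v, h⟩
    have hZ : IsZero ((toSingularity k A).obj P) := (finPerfect k A).isZero_trW_Q_obj
      (DerivedCategory.perfect_single _ ⟨P.property, hP⟩)
    rw [h, Functor.map_comp, hZ.eq_of_tgt ((toSingularity k A).map u) 0, zero_comp]

/-- The functor from the stable category to the singularity category. -/
noncomputable def stableToSingularity : StableCat k A ⥤ SingularityCat k A :=
  CategoryTheory.Quotient.lift _ (toSingularity k A)
    (fun _ _ _ _ h ↦ (toSingularity_map_eq_iff k A _ _).2 h)

instance : (stableToSingularity k A).Additive where
  map_add {X Y f g} := by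
    obtain ⟨f, rfl⟩ := (toStable k A).map_surjective f
    obtain ⟨g, rfl⟩ := (toStable k A).map_surjective g
    rw [← (toStable k A).map_add]
    exact (toSingularity k A).map_add

instance : (stableToSingularity k A).Faithful where
  map_injective {X Y f g} h := by
    obtain ⟨f, rfl⟩ := (toStable k A).map_surjective f
    obtain ⟨g, rfl⟩ := (toStable k A).map_surjective g
    exact (FDMod.toStable_map_eq_iff f g).2 ((toSingularity_map_eq_iff k A f g).1 h)

instance : (toSingularity k A).Full := by
  have := DerivedCategory.full_singleFunctor_comp_Q (P := finProj k A)
    (fun _ ↦ finProj_injective k A) (fun _ ↦ finProj_projective k A)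
  infer_instance

instance : (stableToSingularity k A).Full where
  map_surjective {X Y} f := by
    obtain ⟨g, hg⟩ := (toSingularity k A).map_surjective (X := X.as) (Y := Y.as) f
    exact ⟨(toStable k A).map g, hg⟩

end FrobeniusModules

/-! ### Pulling the triangulation back from the singularity category -/

section FrobeniusTriangulation

attribute [local instance] HasDerivedCategory.standard

variable (k A : Type) [Field k] [Ring A] [Algebra k A] [FrobeniusModules k A]

/-- The connecting morphism of a short exact sequence in the singularity category. -/
noncomputable def toSingularityδ (S : ShortComplex (FDMod k A)) (hS : FDMod.IsShortExact S) :
    (toSingularity k A).obj S.X₃ ⟶ ((toSingularity k A).obj S.X₁)⟦(1 : ℤ)⟧ :=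
  (finPerfect k A).trW.Q.map hS.shortExact.singleδ ≫
    ((finPerfect k A).trW.Q.commShiftIso (1 : ℤ)).hom.app _

lemma toSingularityδ_distinguished (S : ShortComplex (FDMod k A)) (hS : FDMod.IsShortExact S) :
    Triangle.mk ((toSingularity k A).map S.f) ((toSingularity k A).map S.g)
      (toSingularityδ k A S hS) ∈ distTriang (SingularityCat k A) :=
  (finPerfect k A).trW.Q.map_distinguished _ hS.shortExact.singleTriangle_distinguished

lemma toSingularityδ_naturality {S S' : ShortComplex (FDMod k A)} (hS : FDMod.IsShortExact S)
    (hS' : FDMod.IsShortExact S') (φ : S ⟶ S') :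
    (toSingularity k A).map φ.τ₃ ≫ toSingularityδ k A S' hS' =
      toSingularityδ k A S hS ≫ ((toSingularity k A).map φ.τ₁)⟦(1 : ℤ)⟧' :=
  ((finPerfect k A).trW.Q.mapTriangle.map (ShortComplex.ShortExact.singleTriangle.map
    hS.shortExact hS'.shortExact ((isFinDim k A).ι.mapShortComplex.map φ))).comm₃.symm

lemma isZero_toSingularity {P : FDMod k A} (hP : FDMod.proj k A P) :
    IsZero ((toSingularity k A).obj P) :=
  (finPerfect k A).isZero_trW_Q_obj (DerivedCategory.perfect_single _ ⟨P.property, hP⟩)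

/-- Short exact sequences with projective middle term compute the shift. -/
noncomputable def toSingularityShiftIso (S : ShortComplex (FDMod k A))
    (hS : FDMod.IsShortExact S) (hP : FDMod.proj k A S.X₂) :
    (toSingularity k A).obj S.X₃ ≅ ((toSingularity k A).obj S.X₁)⟦(1 : ℤ)⟧ :=
  have : IsIso (toSingularityδ k A S hS) :=
    (Triangle.isZero₂_iff_isIso₃ _ (toSingularityδ_distinguished k A S hS)).1
      (isZero_toSingularity k A hP)
  asIso (toSingularityδ k A S hS)

/-- Projectives vanish in the quotient, so a cokernel of an embedding into a projective is the
shift, and a kernel of a projective cover map is the inverse shift. -/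
instance : (stableToSingularity k A).essImage.IsStableUnderShift ℤ := by
  refine ObjectProperty.isStableUnderShift_int _ ?_ ?_
  · rintro _ ⟨X, ⟨e⟩⟩
    obtain ⟨P, hP, f, hf⟩ := FrobeniusModules.exists_injective X.as
    obtain ⟨C, g, w, h⟩ := FDMod.exists_cokernel f hf
    exact ⟨(toStable k A).obj C, ⟨toSingularityShiftIso k A _ h hP ≪≫
      (shiftFunctor (SingularityCat k A) (1 : ℤ)).mapIso e⟩⟩
  · rintro _ ⟨X, ⟨e⟩⟩
    obtain ⟨P, hP, g, hg⟩ := FrobeniusModules.exists_surjective X.as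
    obtain ⟨M, f, w, h⟩ := FDMod.exists_kernel g hg
    exact ⟨(toStable k A).obj M, ⟨((shiftFunctorCompIsoId (SingularityCat k A) (1 : ℤ) (-1)
      (by simp)).app _).symm ≪≫ (shiftFunctor (SingularityCat k A) (-1 : ℤ)).mapIso
        ((toSingularityShiftIso k A _ h hP).symm ≪≫ e)⟩⟩

/-- The shift on the stable category. -/
@[reducible]
noncomputable def stableHasShift : HasShift (StableCat k A) ℤ :=
  (Functor.FullyFaithful.ofFullyFaithful (stableToSingularity k A)).hasShift
    (stableToSingularity k A).liftShiftFunctor (stableToSingularity k A).liftShiftFunctorIso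

attribute [local instance] stableHasShift

/-- The functor to the singularity category commutes with the shifts. -/
@[reducible]
noncomputable def stableToSingularityCommShift : (stableToSingularity k A).CommShift ℤ :=
  Functor.CommShift.ofHasShiftOfFullyFaithful
    (Functor.FullyFaithful.ofFullyFaithful (stableToSingularity k A))
    (stableToSingularity k A).liftShiftFunctor (stableToSingularity k A).liftShiftFunctorIso

attribute [local instance] stableToSingularityCommShift

lemma stable_shift_additive (n : ℤ) : (shiftFunctor (StableCat k A) n).Additive := by
  have : (shiftFunctor (StableCat k A) n ⋙ stableToSingularity k A).Additive :=
    Functor.additive_of_iso ((stableToSingularity k A).commShiftIso n).symm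
  exact Functor.additive_of_comp_faithful _ (stableToSingularity k A)

attribute [local instance] stable_shift_additive

/-- After adding a projective to the target, which is invisible stably, the morphism is injective
and its cokernel is a cone. -/
lemma stableToSingularity_exists_cone {X Y : StableCat k A} (f : X ⟶ Y) :
    ∃ (Z : StableCat k A) (g : (stableToSingularity k A).obj Y ⟶ (stableToSingularity k A).obj Z)
      (h : (stableToSingularity k A).obj Z ⟶ ((stableToSingularity k A).obj X)⟦(1 : ℤ)⟧),
      Triangle.mk ((stableToSingularity k A).map f) g h ∈ distTriang (SingularityCat k A) := by
  obtain ⟨f, rfl⟩ := (toStable k A).map_surjective (X := X.as) (Y := Y.as) f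
  obtain ⟨P, hP, L, i, g, w, h, hi⟩ := FDMod.exists_shortExact f
  let e := (stableToSingularity k A).mapIso (FDMod.toStableProdIso Y.as hP)
  refine ⟨(toStable k A).obj L, e.inv ≫ (toSingularity k A).map g, toSingularityδ k A _ h, ?_⟩
  refine isomorphic_distinguished _ (toSingularityδ_distinguished k A _ h) _
    (Triangle.isoMk _ _ (Iso.refl _) e.symm (Iso.refl _) ?_ ?_ ?_)
  · change (stableToSingularity k A).map ((toStable k A).map f) ≫ e.inv =
      𝟙 _ ≫ (toSingularity k A).map i
    rw [← hi, Functor.map_comp, Category.assoc, Category.id_comp]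
    exact (congr_arg (_ ≫ ·) e.hom_inv_id).trans (Category.comp_id _)
  · exact Category.comp_id _
  · change toSingularityδ k A _ h ≫ (shiftFunctor (SingularityCat k A) (1 : ℤ)).map (𝟙 _) =
      𝟙 _ ≫ toSingularityδ k A _ h
    rw [CategoryTheory.Functor.map_id, Category.comp_id, Category.id_comp]

/-- The pretriangulated structure on the stable category. -/
@[reducible]
noncomputable def stablePretriangulated : Pretriangulated (StableCat k A) :=
  (stableToSingularity k A).liftPretriangulated (stableToSingularity_exists_cone k A)

attribute [local instance] stablePretriangulated

lemma stableToSingularity_isTriangulated : (stableToSingularity k A).IsTriangulated where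
  map_distinguished _ h := h

/-- The connecting morphism of a short exact sequence in the stable category. -/
noncomputable def stableδ (S : ShortComplex (FDMod k A)) (hS : FDMod.IsShortExact S) :
    (toStable k A).obj S.X₃ ⟶ ((toStable k A).obj S.X₁)⟦(1 : ℤ)⟧ :=
  (stableToSingularity k A).preimage (toSingularityδ k A S hS ≫
    ((stableToSingularity k A).commShiftIso (1 : ℤ)).inv.app ((toStable k A).obj S.X₁))

lemma stableToSingularity_map_stableδ (S : ShortComplex (FDMod k A))
    (hS : FDMod.IsShortExact S) :
    (stableToSingularity k A).map (stableδ k A S hS) = toSingularityδ k A S hS ≫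
      ((stableToSingularity k A).commShiftIso (1 : ℤ)).inv.app ((toStable k A).obj S.X₁) :=
  (stableToSingularity k A).map_preimage _

lemma stableδ_distinguished (S : ShortComplex (FDMod k A)) (hS : FDMod.IsShortExact S) :
    Triangle.mk ((toStable k A).map S.f) ((toStable k A).map S.g) (stableδ k A S hS) ∈
      distTriang (StableCat k A) := by
  change Triangle.mk ((toSingularity k A).map S.f) ((toSingularity k A).map S.g)
    ((stableToSingularity k A).map (stableδ k A S hS) ≫
      ((stableToSingularity k A).commShiftIso (1 : ℤ)).hom.app ((toStable k A).obj S.X₁)) ∈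
    distTriang (SingularityCat k A)
  have h : (stableToSingularity k A).map (stableδ k A S hS) ≫
      ((stableToSingularity k A).commShiftIso (1 : ℤ)).hom.app ((toStable k A).obj S.X₁) =
      toSingularityδ k A S hS := by
    rw [stableToSingularity_map_stableδ]
    exact (Category.assoc _ _ _).trans ((congr_arg (toSingularityδ k A S hS ≫ ·)
      (((stableToSingularity k A).commShiftIso (1 : ℤ)).inv_hom_id_app _)).trans
        (Category.comp_id _))
  exact h ▸ toSingularityδ_distinguished k A S hS

lemma stableδ_naturality {S S' : ShortComplex (FDMod k A)} (hS : FDMod.IsShortExact S)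
    (hS' : FDMod.IsShortExact S') (φ : S ⟶ S') :
    (toStable k A).map φ.τ₃ ≫ stableδ k A S' hS' =
      stableδ k A S hS ≫ ((toStable k A).map φ.τ₁)⟦(1 : ℤ)⟧' := by
  apply (stableToSingularity k A).map_injective
  rw [Functor.map_comp, Functor.map_comp, stableToSingularity_map_stableδ,
    stableToSingularity_map_stableδ]
  have h := ((stableToSingularity k A).commShiftIso (1 : ℤ)).inv.naturality
    ((toStable k A).map φ.τ₁)
  refine Eq.trans ?_ ((congr_arg (toSingularityδ k A S hS ≫ ·) h).trans
    (Category.assoc _ _ _).symm)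
  have h' := toSingularityδ_naturality k A hS hS' φ
  exact (CommSq.mk h').w_assoc
    (((stableToSingularity k A).commShiftIso (1 : ℤ)).inv.app ((toStable k A).obj S'.X₁))

/-- The stable category of a Frobenius algebra is triangulated. -/
theorem nonempty_stableTriangulation : Nonempty (StableTriangulation k A) :=
  ⟨{hasShift := stableHasShift k A
    shift_additive := stable_shift_additive k A
    pretriangulated := stablePretriangulated k A
    isTriangulated := by
      have := stableToSingularity_isTriangulated k A
      exact IsTriangulated.of_fully_faithful_triangulated_functor (stableToSingularity k A)
    connecting := stableδ k A
    connecting_naturality := stableδ_naturality k A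
    distinguished_iff T := by
      constructor
      · intro hT
        obtain ⟨X, Y, Z, f, g, h⟩ := T
        obtain ⟨f, rfl⟩ := (toStable k A).map_surjective (X := X.as) (Y := Y.as) f
        obtain ⟨P, hP, L, i, g, w, hS, hi⟩ := FDMod.exists_shortExact f
        -- A distinguished triangle is determined up to isomorphism by its first morphism, here
        -- replaced by an injection.
        refine ⟨_, hS, ⟨isoTriangleOfIso₁₂ _ _ hT (stableδ_distinguished k A _ hS) (Iso.refl _)
          (FDMod.toStableProdIso Y.as hP).symm ?_⟩⟩
        change (toStable k A).map f ≫ (FDMod.toStableProdIso Y.as hP).inv =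
          𝟙 _ ≫ (toStable k A).map i
        rw [← hi, Category.assoc, Iso.hom_inv_id, Category.comp_id, Category.id_comp]
      · rintro ⟨S, hS, ⟨e⟩⟩
        exact isomorphic_distinguished _ (stableδ_distinguished k A S hS) _ e }⟩

end FrobeniusTriangulation

/-! ### Algebras with a Frobenius form -/

section FrobeniusForm

variable {k A : Type} [Field k] [Ring A] [Algebra k A]

/-- The kernel of the linear form `l` contains no nonzero left ideal. -/
def IsFrobeniusForm (l : A →ₗ[k] k) : Prop :=
  ∀ x : A, (∀ y : A, l (y * x) = 0) → x = 0

namespace IsFrobeniusForm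

variable {l : A →ₗ[k] k} (hl : IsFrobeniusForm l)

include hl

/-- The map from `A` to its dual induced by `l` is injective by nondegeneracy, hence surjective by
dimension. -/
lemma exists_apply_mul [Module.Finite k A] (μ : A →ₗ[k] k) : ∃ x : A, ∀ y, l (y * x) = μ y := by
  let φ : A →ₗ[k] Module.Dual k A := LinearMap.mk₂ k (fun x y ↦ l (y * x))
    (fun _ _ _ ↦ by rw [mul_add, map_add]) (fun _ _ _ ↦ by rw [mul_smul_comm, map_smul])
    (fun _ _ _ ↦ by rw [add_mul, map_add]) (fun _ _ _ ↦ by rw [smul_mul_assoc, map_smul])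
  have hφ : Function.Injective φ := by
    rw [injective_iff_map_eq_zero]
    exact fun x hx ↦ hl x (fun y ↦ LinearMap.congr_fun hx y)
  have hφ' : Function.Surjective φ :=
    (LinearMap.injective_iff_surjective_of_finrank_eq_finrank
      (Subspace.dual_finrank_eq (K := k) (V := A)).symm).1 hφ
  obtain ⟨x, hx⟩ := hφ' μ
  exact ⟨x, fun y ↦ LinearMap.congr_fun hx y⟩

lemma ext_mul {x x' : A} (h : ∀ y, l (y * x) = l (y * x')) : x = x' :=
  sub_eq_zero.1 (hl _ (fun y ↦ by rw [mul_sub, map_sub, h, sub_self]))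

lemma linearMap_ext {M : Type} [AddCommGroup M] [Module A M] {f g : M →ₗ[A] A}
    (h : ∀ m, l (f m) = l (g m)) : f = g := by
  ext m
  exact hl.ext_mul fun y ↦ by simpa using h (y • m)

variable [Module.Finite k A] {M : Type} [AddCommGroup M] [Module k M] [Module A M]
  [IsScalarTower k A M]

/-- The linear forms on a module are induced by the module homomorphisms to the algebra. -/
lemma exists_linearMap (μ : M →ₗ[k] k) : ∃ h : M →ₗ[A] A, ∀ m, l (h m) = μ m := by
  -- The value at `m` is the element representing the form `y ↦ μ (y • m)`; its uniqueness forces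
  -- `A`-linearity.
  choose h hh using fun m : M ↦
    hl.exists_apply_mul (μ ∘ₗ (LinearMap.toSpanSingleton A M m).restrictScalars k)
  refine ⟨{ toFun := h, map_add' m m' := hl.ext_mul fun y ↦ ?_,
            map_smul' a m := hl.ext_mul fun y ↦ ?_ }, fun m ↦ ?_⟩
  · rw [mul_add, map_add, hh, hh, hh]
    simp
  · rw [RingHom.id_apply, smul_eq_mul, ← mul_assoc, hh, hh]
    simp [mul_smul]
  · simpa using hh m 1

/-- Homomorphisms to `A` correspond to linear forms, and linear forms extend along a linear
retraction `r` of `f`. -/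
lemma exists_linearMap_comp_eq {N : Type} [AddCommGroup N] [Module k N] [Module A N]
    [IsScalarTower k A N] (f : M →ₗ[A] N) (hf : Function.Injective f) (g : M →ₗ[A] A) :
    ∃ h : N →ₗ[A] A, ∀ m, h (f m) = g m := by
  obtain ⟨r, hr⟩ := (f.restrictScalars k).exists_leftInverse_of_injective
    (LinearMap.ker_eq_bot.2 hf)
  obtain ⟨h, hh⟩ := hl.exists_linearMap (l ∘ₗ g.restrictScalars k ∘ₗ r)
  refine ⟨h, fun m ↦ LinearMap.congr_fun (hl.linearMap_ext (f := h ∘ₗ f) fun m ↦ ?_) m⟩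
  have := LinearMap.congr_fun hr m
  simp only [LinearMap.comp_apply, LinearMap.restrictScalars_apply, LinearMap.id_apply] at this
  simp [hh, this]

lemma injective_self : Module.Injective A A where
  out X Y _ _ _ _ f hf g := by
    let _ : Module k X := Module.compHom X (algebraMap k A)
    let _ : Module k Y := Module.compHom Y (algebraMap k A)
    have : IsScalarTower k A X := .of_algebraMap_smul fun _ _ ↦ rfl
    have : IsScalarTower k A Y := .of_algebraMap_smul fun _ _ ↦ rfl
    exact hl.exists_linearMap_comp_eq f hf g

/-- Finitely generated projective modules over a Frobenius algebra are injective. -/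
lemma injective_of_projective (P : Type) [AddCommGroup P] [Module A P] [Module.Finite A P]
    [Module.Projective A P] : Module.Injective A P where
  out X Y _ _ _ _ f hf g := by
    obtain ⟨n, p, s, -, -, hps⟩ := Module.Finite.exists_comp_eq_id_of_projective A P
    have := hl.injective_self
    choose h hh using fun i : Fin n ↦
      Module.Injective.out f hf (LinearMap.proj i ∘ₗ s ∘ₗ g)
    refine ⟨p ∘ₗ LinearMap.pi h, fun x ↦ ?_⟩
    have h' : LinearMap.pi h (f x) = s (g x) := by
      ext i
      exact hh i x
    rw [LinearMap.comp_apply, h']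
    exact LinearMap.congr_fun hps (g x)

/-- Lift the coordinate forms of a basis to module homomorphisms; a common zero of the lifts has all
coordinates zero. -/
lemma exists_injective_pi [Module.Finite k M] :
    ∃ (n : ℕ) (f : M →ₗ[A] Fin n → A), Function.Injective f := by
  choose h hh using fun i ↦ hl.exists_linearMap ((Module.finBasis k M).coord i)
  refine ⟨_, LinearMap.pi h, (injective_iff_map_eq_zero _).2 fun m hm ↦ ?_⟩
  refine (Module.finBasis k M).ext_elem fun i ↦ ?_
  have := hh i m
  rw [show h i m = 0 from congr_fun hm i, map_zero] at this
  simpa using this.symm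

end IsFrobeniusForm

lemma isFinDim_of {M : Type} [AddCommGroup M] [Module k M] [Module A M] [IsScalarTower k A M]
    [Module.Finite k M] : isFinDim k A (ModuleCat.of A M) := by
  let e : M →ₗ[k] (ModuleCat.restrictScalars (algebraMap k A)).obj (ModuleCat.of A M) :=
    { toFun := fun m ↦ m
      map_add' := fun _ _ ↦ rfl
      map_smul' := fun c m ↦ (algebraMap_smul A c m).symm }
  exact Module.Finite.of_surjective e (fun m ↦ ⟨m, rfl⟩)

/-- A finite-dimensional module as a vector space. -/
@[reducible]
def FDMod.module (M : FDMod k A) : Module k M.obj :=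
  Module.compHom M.obj (algebraMap k A)

attribute [local instance] FDMod.module

instance (M : FDMod k A) : IsScalarTower k A M.obj := .of_algebraMap_smul fun _ _ ↦ rfl

instance FDMod.finite (M : FDMod k A) : Module.Finite k M.obj := M.property

lemma FDMod.finite_restrictScalars (M : FDMod k A) : Module.Finite A M.obj :=
  Module.Finite.of_restrictScalars_finite k A M.obj

lemma IsFrobeniusForm.frobeniusModules [Module.Finite k A] {l : A →ₗ[k] k}
    (hl : IsFrobeniusForm l) : FrobeniusModules k A where
  injective P hP := by
    have : Module.Projective A P.obj := hP
    have := P.finite_restrictScalars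
    have := hl.injective_of_projective P.obj
    exact Module.injective_object_of_injective_module A P.obj
  exists_injective M := by
    obtain ⟨n, f, hf⟩ := hl.exists_injective_pi (M := M.obj)
    exact ⟨⟨ModuleCat.of A (Fin n → A), isFinDim_of⟩,
      inferInstanceAs (Module.Projective A (Fin n → A)), ObjectProperty.homMk (ModuleCat.ofHom f),
      hf⟩
  exists_surjective M := by
    have := M.finite_restrictScalars
    obtain ⟨n, f, hf⟩ := Module.Finite.exists_fin' A M.obj
    exact ⟨⟨ModuleCat.of A (Fin n → A), isFinDim_of⟩,
      inferInstanceAs (Module.Projective A (Fin n → A)), ObjectProperty.homMk (ModuleCat.ofHom f),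
      hf⟩

end FrobeniusForm

/-! ### The regular representation of the double -/

namespace TaftDouble

/-- The underlying space of the regular representation: the functions of the exponents of
`E`, `F`, `K`, `z`. -/
abbrev Fun (d : ℕ) : Type := ZMod d → ZMod d → ZMod d → ZMod d → ℂ

namespace Fun

variable {d : ℕ} (q : AddChar (ZMod d) ℂ)

/-- The action of `E`. -/
def opE : Module.End ℂ (Fun d) where
  toFun f a b c e := if a = 0 then 0 else f (a - 1) b c e
  map_add' f g := by ext a b c e; by_cases h : a = 0 <;> simp [h]
  map_smul' r f := by ext a b c e; by_cases h : a = 0 <;> simp [h]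

/-- The action of `K`. -/
noncomputable def opK : Module.End ℂ (Fun d) where
  toFun f a b c e := q (a - b) * f a b (c - 1) e
  map_add' f g := by ext a b c e; simp [mul_add]
  map_smul' r f := by ext a b c e; simp [mul_left_comm]

/-- The action of `K⁻¹`. -/
noncomputable def opKinv : Module.End ℂ (Fun d) where
  toFun f a b c e := q (b - a) * f a b (c + 1) e
  map_add' f g := by ext a b c e; simp [mul_add]
  map_smul' r f := by ext a b c e; simp [mul_left_comm]

/-- The action of `z`. -/
def opz : Module.End ℂ (Fun d) where
  toFun f a b c e := f a b c (e - 1)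
  map_add' _ _ := rfl
  map_smul' _ _ := rfl

/-- The sum of `q i` for `0 ≤ i < a`. -/
noncomputable def geom (a : ZMod d) : ℂ := (q a - 1) / (q 1 - 1)

/-- The action of `F`. -/
noncomputable def opF : Module.End ℂ (Fun d) where
  -- Here `f` is the array of coefficients of the products `E ^ a * F ^ b * K ^ c * z ^ e`. The
  -- first term moves `F` past `E ^ a`; the others are the commutator, with the geometric sums of `q
  -- 1` and its inverse. They vanish at `a + 1 = 0`, so nothing wraps around.
  toFun f a b c e := (if b = 0 then 0 else f a (b - 1) c e) -
    (geom q (a + 1) * q (-b) * f (a + 1) b (c - 1) e -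
      geom q⁻¹ (a + 1) * q b * f (a + 1) b (c + 1) (e - 1))
  map_add' f g := by
    ext a b c e
    by_cases h : b = 0
    · simp [h]; ring
    · simp [h]; ring
  map_smul' r f := by
    ext a b c e
    by_cases h : b = 0
    · simp [h]; ring
    · simp [h]; ring

lemma opE_apply (f : Fun d) (a b c e) :
    opE f a b c e = if a = 0 then 0 else f (a - 1) b c e := rfl

lemma opK_apply (f : Fun d) (a b c e) : opK q f a b c e = q (a - b) * f a b (c - 1) e := rfl

lemma opKinv_apply (f : Fun d) (a b c e) :
    opKinv q f a b c e = q (b - a) * f a b (c + 1) e := rfl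

lemma opz_apply (f : Fun d) (a b c e) : opz f a b c e = f a b c (e - 1) := rfl

lemma opF_apply (f : Fun d) (a b c e) :
    opF q f a b c e = (if b = 0 then 0 else f a (b - 1) c e) -
      (geom q (a + 1) * q (-b) * f (a + 1) b (c - 1) e -
        geom q⁻¹ (a + 1) * q b * f (a + 1) b (c + 1) (e - 1)) := rfl

@[simp]
lemma geom_zero : geom q 0 = 0 := by simp [geom]

variable {q} in
lemma geom_add_one (hq : q 1 ≠ 1) (a : ZMod d) : geom q (a + 1) = geom q a + q a := by
  have := sub_ne_zero.2 hq
  rw [geom, geom, AddChar.map_add_eq_mul]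
  field_simp
  ring

variable {q} in
lemma inv_one_ne_one (hq : q 1 ≠ 1) : q⁻¹ 1 ≠ 1 := by
  rw [AddChar.inv_apply, AddChar.map_neg_eq_inv]
  simpa using hq

lemma opz_commute_opE : Commute opz (opE (d := d)) := by
  ext f a b c e; rfl

lemma opz_commute_opK : Commute opz (opK q) := by
  ext f a b c e; rfl

lemma opz_commute_opF : Commute opz (opF q) := by
  ext f a b c e; rfl

lemma opK_mul_opE : opK q * opE = q 1 • (opE * opK q) := by
  refine LinearMap.ext fun f ↦ ?_
  ext a b c e
  have : q (a - b) = q 1 * q (a - 1 - b) := by rw [← AddChar.map_add_eq_mul]; congr 1; ring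
  simp only [Module.End.mul_apply, LinearMap.smul_apply, Pi.smul_apply, opK_apply, opE_apply,
    smul_eq_mul, this]
  split_ifs <;> ring

lemma opK_mul_opF : opK q * opF q = (q 1)⁻¹ • (opF q * opK q) := by
  refine LinearMap.ext fun f ↦ ?_
  ext a b c e
  have h₁ : q (a - (b - 1)) = q 1 * q (a - b) := by
    rw [← AddChar.map_add_eq_mul]; congr 1; ring
  have h₂ : q (a + 1 - b) = q 1 * q (a - b) := by
    rw [← AddChar.map_add_eq_mul]; congr 1; ring
  have h₀ : q 1 ≠ 0 := (AddChar.val_isUnit q 1).ne_zero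
  simp only [Module.End.mul_apply, LinearMap.smul_apply, Pi.smul_apply, opK_apply, opF_apply,
    smul_eq_mul, h₁, h₂, add_sub_right_comm c 1 1]
  split_ifs
  · field_simp
    ring
  · field_simp

lemma opK_mul_opKinv : opK q * opKinv q = 1 := by
  refine LinearMap.ext fun f ↦ ?_
  ext a b c e
  have h : q (a - b) * q (b - a) = 1 := by
    rw [← AddChar.map_add_eq_mul, sub_add_sub_cancel, sub_self, AddChar.map_zero_eq_one]
  simp [Module.End.mul_apply, opK_apply, opKinv_apply, ← mul_assoc, h]

variable {q} in
lemma opE_mul_opF_sub (hq : q 1 ≠ 1) :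
    opE * opF q - opF q * opE = opK q - opz * opKinv q := by
  refine LinearMap.ext fun f ↦ ?_
  ext a b c e
  have h₁ : q (a - b) = q a * q (-b) := by rw [← AddChar.map_add_eq_mul, sub_eq_add_neg]
  have h₂ : q (b - a) = q (-a) * q b := by
    rw [← AddChar.map_add_eq_mul, sub_eq_add_neg, add_comm]
  have g₁ := geom_add_one hq a
  have g₂ := geom_add_one (inv_one_ne_one hq) a
  rw [AddChar.inv_apply] at g₂
  simp only [Module.End.mul_apply, LinearMap.sub_apply, Pi.sub_apply, opK_apply, opF_apply,
    opE_apply, opz_apply, opKinv_apply, add_sub_cancel_right, sub_add_cancel, h₁, h₂]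
  -- The cut-off of `E` matters at `a = 0` and the vanishing of `geom` at `a + 1 = 0`; elsewhere the
  -- recursion for `geom` gives the relation.
  by_cases ha : a = 0
  · subst ha
    rw [geom_zero, zero_add] at g₁ g₂
    by_cases h1 : (1 : ZMod d) = 0
    · exact absurd (by rw [h1, AddChar.map_zero_eq_one]) hq
    · simp [h1, g₁, g₂]
  · by_cases h1 : a + 1 = 0
    · rw [h1, geom_zero] at g₁ g₂
      simp [ha, h1, eq_neg_of_add_eq_zero_right g₁.symm, eq_neg_of_add_eq_zero_right g₂.symm]
      ring
    · simp only [ha, h1, if_false, g₁, g₂]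
      split_ifs <;> ring

lemma opK_pow_apply (n : ℕ) (f : Fun d) (a b c e) :
    (opK q ^ n) f a b c e = q (a - b) ^ n * f a b (c - n) e := by
  induction n generalizing c with
  | zero => simp
  | succ n ih =>
    rw [pow_succ', Module.End.mul_apply, opK_apply, ih, ← mul_assoc, ← pow_succ']
    congr 2
    push_cast
    ring

lemma opz_pow_apply (n : ℕ) (f : Fun d) (a b c e) :
    (opz ^ n) f a b c e = f a b c (e - n) := by
  induction n generalizing e with
  | zero => simp
  | succ n ih =>
    rw [pow_succ', Module.End.mul_apply, opz_apply, ih]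
    congr 1
    push_cast
    ring

lemma opK_pow : opK q ^ d = 1 := by
  refine LinearMap.ext fun f ↦ ?_
  ext a b c e
  rw [opK_pow_apply, ← AddChar.map_nsmul_eq_pow]
  simp

lemma opz_pow : (opz : Module.End ℂ (Fun d)) ^ d = 1 := by
  refine LinearMap.ext fun f ↦ ?_
  ext a b c e
  simp [opz_pow_apply]

lemma opK_pow_pred [NeZero d] : opK q ^ (d - 1) = opKinv q := by
  calc opK q ^ (d - 1) = opK q ^ (d - 1) * (opK q * opKinv q) := by rw [opK_mul_opKinv, mul_one]
    _ = opKinv q := by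
      rw [← mul_assoc, ← pow_succ, Nat.sub_add_cancel NeZero.one_le, opK_pow, one_mul]

/-- Shifting a function on `ZMod d` and discarding what passes the end. -/
lemma truncShift_succ [NeZero d] (n : ℕ) (u : ZMod d → ℂ) (a : ZMod d) :
    (if a = 0 then 0 else if (a - 1).val < n then 0 else u (a - 1 - n)) =
      if a.val < n + 1 then 0 else u (a - (n + 1 : ℕ)) := by
  by_cases ha : a = 0
  · simp [ha]
  · have h : (a - 1).val + 1 = a.val := by
      have h0 : a.val ≠ 0 := by simpa using ha
      have h1 : a - 1 = ((a.val - 1 : ℕ) : ZMod d) := by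
        rw [Nat.cast_sub (by lia)]
        simp
      rw [h1, ZMod.val_natCast, Nat.mod_eq_of_lt (by have := a.val_lt; lia)]
      lia
    have h' : a - 1 - (n : ZMod d) = a - (n + 1 : ℕ) := by push_cast; ring
    simp only [ha, if_false, h', ← h, Nat.add_lt_add_iff_right]

lemma opE_pow_apply [NeZero d] (n : ℕ) (f : Fun d) (a b c e) :
    (opE ^ n) f a b c e = if a.val < n then 0 else f (a - n) b c e := by
  induction n generalizing a with
  | zero => simp
  | succ n ih =>
    rw [pow_succ', Module.End.mul_apply, opE_apply, ih]
    exact truncShift_succ n (fun a ↦ f a b c e) a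

lemma opE_pow [NeZero d] : (opE : Module.End ℂ (Fun d)) ^ d = 0 := by
  refine LinearMap.ext fun f ↦ ?_
  ext a b c e
  simp [opE_pow_apply, a.val_lt]

/-- When the layer `a + 1` contributes nothing, `F` acts on the layer `a` as a truncated shift in
`b`. -/
lemma opF_pow_apply_of_eq_zero [NeZero d] (n : ℕ) (f : Fun d) (a : ZMod d)
    (h : a + 1 = 0 ∨ ∀ n b c e, (opF q ^ n) f (a + 1) b c e = 0) (b c e) :
    (opF q ^ n) f a b c e = if b.val < n then 0 else f a (b - n) c e := by
  induction n generalizing b c e with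
  | zero => simp
  | succ n ih =>
    rw [pow_succ', Module.End.mul_apply, opF_apply, ih, ← truncShift_succ n (f a · c e) b]
    rcases h with h | h
    · simp [h]
    · simp [h]

/-- `F` only carries values from a layer to itself and to the one below, and never from layer 0 back
to the top, since `geom` vanishes there. -/
lemma opF_pow_apply_of_ne_zero (n : ℕ) (f : Fun d) (hf : ∀ a ≠ 0, f a = 0) :
    ∀ a ≠ 0, (opF q ^ n) f a = 0 := by
  induction n with
  | zero => exact hf
  | succ n ih =>
    intro a ha
    ext b c e
    rw [pow_succ', Module.End.mul_apply, opF_apply, ih a ha]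
    by_cases h : a + 1 = 0
    · simp [h]
    · simp [ih _ h]

variable {q} in
lemma opE_mul_opF_pow_succ (hq : q 1 ≠ 1) (n : ℕ) :
    opE * opF q ^ (n + 1) = opF q ^ (n + 1) * opE +
      opF q ^ n * ((∑ i ∈ Finset.range (n + 1), (q 1)⁻¹ ^ i) • opK q -
        (∑ i ∈ Finset.range (n + 1), q 1 ^ i) • (opz * opKinv q)) := by
  have h₀ := sub_eq_iff_eq_add.1 (opE_mul_opF_sub hq)
  have h₁ := opK_mul_opF q
  have h₀' : q 1 ≠ 0 := (AddChar.val_isUnit q 1).ne_zero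
  have h₂ : opz * opKinv q * opF q = q 1 • (opF q * (opz * opKinv q)) := by
    refine LinearMap.ext fun f ↦ ?_
    ext a b c e
    have h₁ : q (b - 1 - a) = (q 1)⁻¹ * q (b - a) := by
      rw [← AddChar.map_neg_eq_inv, ← AddChar.map_add_eq_mul]; congr 1; ring
    have h₂ : q (b - (a + 1)) = (q 1)⁻¹ * q (b - a) := by
      rw [← AddChar.map_neg_eq_inv, ← AddChar.map_add_eq_mul]; congr 1; ring
    simp only [Module.End.mul_apply, LinearMap.smul_apply, Pi.smul_apply, opKinv_apply, opF_apply,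
      opz_apply, smul_eq_mul, h₁, h₂, add_sub_right_comm c 1 1]
    split_ifs
    · field_simp
      ring
    · field_simp
  induction n with
  | zero => simp [h₀, add_comm]
  | succ n ih =>
    rw [pow_succ (opF q) (n + 1), ← mul_assoc, ih, add_mul, mul_assoc _ opE, h₀,
      mul_assoc _ _ (opF q), sub_mul, smul_mul_assoc, smul_mul_assoc, h₁, h₂, geom_sum_succ (n := n + 1),
      geom_sum_succ (n := n + 1), pow_succ (opF q) n]
    simp only [mul_add, mul_sub, mul_smul_comm, add_smul, smul_smul, mul_assoc, one_smul,
      mul_comm (q 1), mul_comm (q 1)⁻¹]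
    abel

variable {q} in
-- The commutator of `E` with `F ^ d` carries the sums of the first `d` powers of `q 1` and its
-- inverse, which are zero.
lemma commute_opE_opF_pow [NeZero d] (hq : q 1 ≠ 1) : Commute opE (opF q ^ d) := by
  have h (x : ℂ) (h1 : x ≠ 1) (hx : x ^ d = 1) : ∑ i ∈ Finset.range d, x ^ i = 0 := by
    rw [geom_sum_eq h1, hx, sub_self, zero_div]
  have hd : q 1 ^ d = 1 := by rw [← AddChar.map_nsmul_eq_pow]; simp
  have := opE_mul_opF_pow_succ hq (d - 1)
  rwa [Nat.sub_add_cancel NeZero.one_le, h _ hq hd, h _ (by simpa using hq) (by simp [hd]),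
    zero_smul, zero_smul, sub_zero, mul_zero, add_zero] at this

lemma val_le_val_neg_one [NeZero d] (a : ZMod d) : a.val ≤ (-1 : ZMod d).val := by
  obtain ⟨n, rfl⟩ := Nat.exists_eq_succ_of_ne_zero (NeZero.ne d)
  rw [ZMod.val_neg_one]
  exact Nat.lt_succ_iff.1 a.val_lt

lemma opE_pow_apply_neg_one [NeZero d] (f : Fun d) (a b c e) :
    (opE ^ (-1 - a).val) f (-1) b c e = f a b c e := by
  rw [opE_pow_apply, if_neg (val_le_val_neg_one _).not_gt, ZMod.natCast_zmod_val, sub_sub_cancel]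

lemma opF_pow_apply_neg_one [NeZero d] (n : ℕ) (f : Fun d) (b c e) :
    (opF q ^ n) f (-1) b c e = if b.val < n then 0 else f (-1) (b - n) c e :=
  opF_pow_apply_of_eq_zero q n f _ (.inl (neg_add_cancel 1)) b c e

variable {q} in
-- On the top layer `a = -1`, `F` is a truncated shift and `F ^ d` vanishes. Any other layer is
-- moved to the top by a power of `E`, which commutes with `F ^ d`.
lemma opF_pow [NeZero d] (hq : q 1 ≠ 1) : opF q ^ d = 0 := by
  refine LinearMap.ext fun f ↦ ?_
  ext a b c e
  rw [← opE_pow_apply_neg_one ((opF q ^ d) f), ← Module.End.mul_apply,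
    ((commute_opE_opF_pow hq).pow_left (-1 - a).val).eq, Module.End.mul_apply,
    opF_pow_apply_neg_one, if_pos b.val_lt]
  rfl

end Fun

end TaftDouble

/-! ### Bases of the Taft algebra and of its double -/

/-- A subspace stable under left multiplication by the generators is a left ideal; containing `1`,
it is everything. -/
lemma RingQuot.submodule_eq_top {R X : Type*} [CommSemiring R]
    {r : FreeAlgebra R X → FreeAlgebra R X → Prop} (N : Submodule R (RingQuot r)) (h1 : 1 ∈ N)
    (h : ∀ x, ∀ n ∈ N, RingQuot.mkAlgHom R r (FreeAlgebra.ι R x) * n ∈ N) : N = ⊤ := by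
  have key (a : FreeAlgebra R X) : ∀ n ∈ N, RingQuot.mkAlgHom R r a * n ∈ N := by
    induction a using FreeAlgebra.induction with
    | grade0 c =>
      intro n hn
      rw [AlgHom.commutes, ← Algebra.smul_def]
      exact N.smul_mem c hn
    | grade1 x => exact h x
    | mul a b ha hb =>
      intro n hn
      rw [map_mul, mul_assoc]
      exact ha _ (hb _ hn)
    | add a b ha hb =>
      intro n hn
      rw [map_add, add_mul]
      exact N.add_mem (ha _ hn) (hb _ hn)
  refine eq_top_iff.2 fun x _ ↦ ?_
  obtain ⟨a, rfl⟩ := RingQuot.mkAlgHom_surjective R r x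
  simpa using key a 1 h1

namespace TaftAlg

variable (d : ℕ) (ζ : ℂ)

/-- The generators of `B` as elements of `B`. -/
noncomputable def gen (g : TaftGen) : TaftAlg d ζ :=
  RingQuot.mkAlgHom ℂ (TaftRel d ζ) (FreeAlgebra.ι ℂ g)

lemma K_pow : gen d ζ .K ^ d = 1 := by
  simpa [gen] using RingQuot.mkAlgHom_rel ℂ (TaftRel.K_pow (d := d) (ζ := ζ))

lemma E_pow : gen d ζ .E ^ d = 0 := by
  simpa [gen] using RingQuot.mkAlgHom_rel ℂ (TaftRel.E_pow (d := d) (ζ := ζ))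

lemma K_mul_E : gen d ζ .K * gen d ζ .E = ζ • (gen d ζ .E * gen d ζ .K) := by
  simpa [gen] using RingQuot.mkAlgHom_rel ℂ (TaftRel.K_E (d := d) (ζ := ζ))

lemma toDouble_K : toDouble d ζ (gen d ζ .K) = TaftDouble.gen d ζ .K := by
  simp [gen, toDouble]

lemma toDouble_E : toDouble d ζ (gen d ζ .E) = TaftDouble.gen d ζ .E := by
  simp [gen, toDouble]

end TaftAlg

section

variable {R A : Type*} [CommSemiring R] [Semiring A] [Algebra R A]

lemma mul_pow_eq_smul_of_mul_eq_smul {ζ : R} {x y : A} (h : x * y = ζ • (y * x)) (n : ℕ) :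
    x * y ^ n = ζ ^ n • (y ^ n * x) := by
  induction n with
  | zero => simp
  | succ n ih =>
    rw [pow_succ, ← mul_assoc, ih, smul_mul_assoc, mul_assoc, h, mul_smul_comm, smul_smul,
      ← pow_succ, mul_assoc]

lemma pow_eq_pow_val_of_pow_eq_one {d : ℕ} {x : A} (h : x ^ d = 1) (n : ℕ) :
    x ^ (n : ZMod d).val = x ^ n := by
  rw [ZMod.val_natCast]
  exact (pow_eq_pow_mod n h).symm

/-- Reducing an exponent modulo `d` either changes nothing or concerns a power that is zero. -/
lemma pow_eq_pow_val_of_pow_eq_zero {d : ℕ} {x : A} (h : x ^ d = 0) (n : ℕ) :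
    x ^ (n : ZMod d).val = x ^ n ∨ x ^ n = 0 := by
  rw [ZMod.val_natCast]
  rcases lt_or_ge n d with hn | hn
  · exact .inl (by rw [Nat.mod_eq_of_lt hn])
  · exact .inr (pow_eq_zero_of_le hn h)

end

namespace TaftAlg

variable (d : ℕ) (ζ : ℂ)

/-- The monomials `E ^ i K ^ l`. -/
noncomputable def monomial (p : ZMod d × ZMod d) : TaftAlg d ζ :=
  gen d ζ .E ^ p.1.val * gen d ζ .K ^ p.2.val

lemma monomial_mem (i l : ℕ) :
    gen d ζ .E ^ i * gen d ζ .K ^ l ∈ Submodule.span ℂ (Set.range (monomial d ζ)) := by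
  rcases pow_eq_pow_val_of_pow_eq_zero (E_pow d ζ) i with hi | hi
  · rw [← hi, ← pow_eq_pow_val_of_pow_eq_one (K_pow d ζ) l]
    exact Submodule.subset_span ⟨(i, l), rfl⟩
  · rw [hi, zero_mul]
    exact Submodule.zero_mem _

lemma span_monomial : Submodule.span ℂ (Set.range (monomial d ζ)) = ⊤ := by
  apply RingQuot.submodule_eq_top
  · simpa using monomial_mem d ζ 0 0
  · intro x n hn
    change gen d ζ x * n ∈ _
    induction hn using Submodule.span_induction with
    | zero => simp
    | add a b _ _ ha hb => rw [mul_add]; exact Submodule.add_mem _ ha hb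
    | smul c a _ ha => rw [mul_smul_comm]; exact Submodule.smul_mem _ c ha
    | mem a ha =>
      obtain ⟨p, rfl⟩ := ha
      rw [monomial, ← mul_assoc]
      cases x with
      | K =>
        rw [mul_pow_eq_smul_of_mul_eq_smul (K_mul_E d ζ), smul_mul_assoc, mul_assoc, ← pow_succ']
        exact Submodule.smul_mem _ _ (monomial_mem d ζ _ _)
      | E =>
        rw [← pow_succ']
        exact monomial_mem d ζ _ _

lemma exists_eq_sum (x : TaftAlg d ζ) [NeZero d] :
    ∃ c : ZMod d → ZMod d → ℂ, x = ∑ i, ∑ l, c i l • monomial d ζ (i, l) := by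
  have : x ∈ Submodule.span ℂ (Set.range (monomial d ζ)) := by
    rw [span_monomial]
    trivial
  obtain ⟨c, rfl⟩ := (Submodule.mem_span_range_iff_exists_fun ℂ).1 this
  exact ⟨fun i l ↦ c (i, l), Fintype.sum_prod_type _⟩

instance finite [NeZero d] : Module.Finite ℂ (TaftAlg d ζ) :=
  Module.finite_def.2 ⟨(Set.finite_range (monomial d ζ)).toFinset, by simpa using span_monomial d ζ⟩

end TaftAlg

namespace TaftDouble

variable (d : ℕ) (ζ : ℂ)

lemma K_pow : gen d ζ .K ^ d = 1 := by
  simpa [gen] using RingQuot.mkAlgHom_rel ℂ (TaftDoubleRel.K_pow (d := d) (ζ := ζ))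

lemma z_pow : gen d ζ .z ^ d = 1 := by
  simpa [gen] using RingQuot.mkAlgHom_rel ℂ (TaftDoubleRel.z_pow (d := d) (ζ := ζ))

lemma E_pow : gen d ζ .E ^ d = 0 := by
  simpa [gen] using RingQuot.mkAlgHom_rel ℂ (TaftDoubleRel.E_pow (d := d) (ζ := ζ))

lemma F_pow : gen d ζ .F ^ d = 0 := by
  simpa [gen] using RingQuot.mkAlgHom_rel ℂ (TaftDoubleRel.F_pow (d := d) (ζ := ζ))

lemma z_commute (g : TaftDoubleGen) : Commute (gen d ζ .z) (gen d ζ g) := by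
  simpa [gen] using! RingQuot.mkAlgHom_rel ℂ (TaftDoubleRel.z_comm (d := d) (ζ := ζ) g)

lemma K_mul_E : gen d ζ .K * gen d ζ .E = ζ • (gen d ζ .E * gen d ζ .K) := by
  simpa [gen] using RingQuot.mkAlgHom_rel ℂ (TaftDoubleRel.K_E (d := d) (ζ := ζ))

lemma K_mul_F : gen d ζ .K * gen d ζ .F = ζ⁻¹ • (gen d ζ .F * gen d ζ .K) := by
  simpa [gen] using RingQuot.mkAlgHom_rel ℂ (TaftDoubleRel.K_F (d := d) (ζ := ζ))

lemma E_mul_F_sub : gen d ζ .E * gen d ζ .F - gen d ζ .F * gen d ζ .E =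
    gen d ζ .K - gen d ζ .z * gen d ζ .K ^ (d - 1) := by
  simpa [gen] using RingQuot.mkAlgHom_rel ℂ (TaftDoubleRel.E_F (d := d) (ζ := ζ))

/-- The monomials `E ^ i K ^ l F ^ j z ^ m`. -/
noncomputable def monomial (p : (ZMod d × ZMod d) × (ZMod d × ZMod d)) : TaftDouble d ζ :=
  gen d ζ .E ^ p.1.1.val * gen d ζ .K ^ p.1.2.val *
    (gen d ζ .F ^ p.2.1.val * gen d ζ .z ^ p.2.2.val)

lemma toDouble_monomial_mul (i l j m : ZMod d) :
    TaftAlg.toDouble d ζ (TaftAlg.monomial d ζ (i, l)) *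
      (gen d ζ .F ^ j.val * gen d ζ .z ^ m.val) = monomial d ζ ((i, l), (j, m)) := by
  rw [TaftAlg.monomial, map_mul, map_pow, map_pow, TaftAlg.toDouble_E, TaftAlg.toDouble_K]
  rfl

lemma monomial_mem (i l j m : ℕ) :
    gen d ζ .E ^ i * gen d ζ .K ^ l * (gen d ζ .F ^ j * gen d ζ .z ^ m) ∈
      Submodule.span ℂ (Set.range (monomial d ζ)) := by
  rcases pow_eq_pow_val_of_pow_eq_zero (E_pow d ζ) i with hi | hi
  · rcases pow_eq_pow_val_of_pow_eq_zero (F_pow d ζ) j with hj | hj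
    · rw [← hi, ← hj, ← pow_eq_pow_val_of_pow_eq_one (K_pow d ζ) l,
        ← pow_eq_pow_val_of_pow_eq_one (z_pow d ζ) m]
      exact Submodule.subset_span ⟨((i, l), (j, m)), rfl⟩
    · rw [hj, zero_mul, mul_zero]
      exact Submodule.zero_mem _
  · rw [hi, zero_mul, zero_mul]
    exact Submodule.zero_mem _

lemma gen_mul_mem_span_of (x : TaftDoubleGen)
    (h : ∀ i l j m : ℕ, gen d ζ x *
      (gen d ζ .E ^ i * gen d ζ .K ^ l * (gen d ζ .F ^ j * gen d ζ .z ^ m)) ∈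
        Submodule.span ℂ (Set.range (monomial d ζ))) :
    ∀ n ∈ Submodule.span ℂ (Set.range (monomial d ζ)),
      gen d ζ x * n ∈ Submodule.span ℂ (Set.range (monomial d ζ)) := by
  intro n hn
  induction hn using Submodule.span_induction with
  | zero => simp
  | add a b _ _ ha hb => rw [mul_add]; exact Submodule.add_mem _ ha hb
  | smul c a _ ha => rw [mul_smul_comm]; exact Submodule.smul_mem _ c ha
  | mem a ha =>
    obtain ⟨p, rfl⟩ := ha
    exact h _ _ _ _

lemma E_mul_mem_span : ∀ n ∈ Submodule.span ℂ (Set.range (monomial d ζ)),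
    gen d ζ .E * n ∈ Submodule.span ℂ (Set.range (monomial d ζ)) :=
  gen_mul_mem_span_of d ζ _ fun i l j m ↦ by
    rw [← mul_assoc _ (_ * _) (_ * _), ← mul_assoc _ (_ ^ i) (_ ^ l), ← pow_succ']
    exact monomial_mem d ζ _ _ _ _

lemma K_mul_mem_span : ∀ n ∈ Submodule.span ℂ (Set.range (monomial d ζ)),
    gen d ζ .K * n ∈ Submodule.span ℂ (Set.range (monomial d ζ)) :=
  gen_mul_mem_span_of d ζ _ fun i l j m ↦ by
    rw [← mul_assoc _ (_ * _) (_ * _), ← mul_assoc _ (_ ^ i) (_ ^ l),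
      mul_pow_eq_smul_of_mul_eq_smul (K_mul_E d ζ), smul_mul_assoc, mul_assoc, ← pow_succ', smul_mul_assoc]
    exact Submodule.smul_mem _ _ (monomial_mem d ζ _ _ _ _)

lemma z_mul_mem_span : ∀ n ∈ Submodule.span ℂ (Set.range (monomial d ζ)),
    gen d ζ .z * n ∈ Submodule.span ℂ (Set.range (monomial d ζ)) :=
  gen_mul_mem_span_of d ζ _ fun i l j m ↦ by
    rw [← mul_assoc, (((z_commute d ζ .E).pow_right i).mul_right
      ((z_commute d ζ .K).pow_right l)).eq, mul_assoc, ← mul_assoc (gen d ζ .z),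
      ((z_commute d ζ .F).pow_right j).eq, mul_assoc (_ ^ j), ← pow_succ']
    exact monomial_mem d ζ _ _ _ _

lemma K_pow_mul_mem_span (n : ℕ) {x : TaftDouble d ζ}
    (hx : x ∈ Submodule.span ℂ (Set.range (monomial d ζ))) :
    gen d ζ .K ^ n * x ∈ Submodule.span ℂ (Set.range (monomial d ζ)) := by
  induction n with
  | zero => simpa using hx
  | succ n ih =>
    rw [pow_succ', mul_assoc]
    exact K_mul_mem_span d ζ _ ih

variable {ζ} in
lemma F_mul_K (hζ : ζ ≠ 0) : gen d ζ .F * gen d ζ .K = ζ • (gen d ζ .K * gen d ζ .F) := by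
  rw [K_mul_F, smul_smul, mul_inv_cancel₀ hζ, one_smul]

variable {ζ} in
lemma F_mul_mem_span (hζ : ζ ≠ 0) : ∀ n ∈ Submodule.span ℂ (Set.range (monomial d ζ)),
    gen d ζ .F * n ∈ Submodule.span ℂ (Set.range (monomial d ζ)) :=
  gen_mul_mem_span_of d ζ _ fun i l j m ↦ by
    -- `F` is pushed past `E` one factor at a time; each commutator leaves a monomial with fewer
    -- factors `E`, multiplied by `K` and `z`.
    induction i with
    | zero =>
      rw [pow_zero, one_mul, ← mul_assoc, mul_pow_eq_smul_of_mul_eq_smul (F_mul_K d hζ),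
        smul_mul_assoc, mul_assoc, ← mul_assoc _ (_ ^ j), ← pow_succ']
      simpa using Submodule.smul_mem _ (ζ ^ l) (monomial_mem d ζ 0 l (j + 1) m)
    | succ i ih =>
      have h : gen d ζ .F * gen d ζ .E = gen d ζ .E * gen d ζ .F -
          (gen d ζ .K - gen d ζ .z * gen d ζ .K ^ (d - 1)) := by
        rw [← E_mul_F_sub, sub_sub_cancel]
      have hm := monomial_mem d ζ i l j m
      generalize hw : gen d ζ .E ^ i * gen d ζ .K ^ l * (gen d ζ .F ^ j * gen d ζ .z ^ m) = w
        at ih hm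
      rw [pow_succ', mul_assoc, mul_assoc, ← mul_assoc (_ ^ i), hw, ← mul_assoc, h, sub_mul,
        sub_mul, mul_assoc, mul_assoc]
      exact Submodule.sub_mem _ (E_mul_mem_span d ζ _ ih) (Submodule.sub_mem _
        (K_mul_mem_span d ζ _ hm) (z_mul_mem_span d ζ _ (K_pow_mul_mem_span d ζ _ hm)))

variable {ζ}

lemma span_monomial (hζ : ζ ≠ 0) : Submodule.span ℂ (Set.range (monomial d ζ)) = ⊤ := by
  apply RingQuot.submodule_eq_top
  · simpa using monomial_mem d ζ 0 0 0 0
  · rintro (_ | _ | _ | _)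
    · exact E_mul_mem_span d ζ
    · exact F_mul_mem_span d hζ
    · exact K_mul_mem_span d ζ
    · exact z_mul_mem_span d ζ

lemma exists_eq_sum [NeZero d] (hζ : ζ ≠ 0) (x : TaftDouble d ζ) :
    ∃ c : ZMod d × ZMod d → ZMod d × ZMod d → ℂ,
      x = ∑ s, ∑ p, c p s • monomial d ζ (p, s) := by
  have : x ∈ Submodule.span ℂ (Set.range (monomial d ζ)) := by
    rw [span_monomial d hζ]
    trivial
  obtain ⟨c, rfl⟩ := (Submodule.mem_span_range_iff_exists_fun ℂ).1 this
  exact ⟨fun p s ↦ c (p, s), Fintype.sum_prod_type_right _⟩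

lemma finite [NeZero d] (hζ : ζ ≠ 0) : Module.Finite ℂ (TaftDouble d ζ) :=
  Module.finite_def.2 ⟨(Set.finite_range (monomial d ζ)).toFinset,
    by simpa using span_monomial d hζ⟩

end TaftDouble

/-! ### Frobenius forms on the Taft algebra and on its double -/

namespace TaftDouble

open Fun

variable {d : ℕ} [NeZero d] {q : AddChar (ZMod d) ℂ} (hq : q 1 ≠ 1)

/-- The regular representation of the double on functions. -/
noncomputable def rep : TaftDouble d (q 1) →ₐ[ℂ] Module.End ℂ (Fun d) :=
  RingQuot.liftAlgHom ℂ ⟨FreeAlgebra.lift ℂ (fun g => match g with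
    | .E => opE
    | .F => opF q
    | .K => opK q
    | .z => opz), by
    intro x y h
    cases h with
    | K_pow => simpa using opK_pow q
    | z_pow => simpa using opz_pow
    | E_pow =>
      rw [map_pow, map_zero, FreeAlgebra.lift_ι_apply]
      exact opE_pow
    | F_pow =>
      rw [map_pow, map_zero, FreeAlgebra.lift_ι_apply]
      exact opF_pow hq
    | z_comm g =>
      cases g with
      | E => simpa using opz_commute_opE.eq
      | F => simpa using (opz_commute_opF q).eq
      | K => simpa using (opz_commute_opK q).eq
      | z => rfl
    | K_E => simpa using opK_mul_opE q
    | K_F => simpa using opK_mul_opF q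
    | E_F => simpa [opK_pow_pred] using opE_mul_opF_sub hq⟩

lemma rep_E : rep hq (gen d (q 1) .E) = opE := by simp [rep, gen]

lemma rep_F : rep hq (gen d (q 1) .F) = opF q := by simp [rep, gen]

lemma rep_K : rep hq (gen d (q 1) .K) = opK q := by simp [rep, gen]

lemma rep_z : rep hq (gen d (q 1) .z) = opz := by simp [rep, gen]

/-- The vacuum vector of the regular representation. -/
def vac (d : ℕ) : Fun d := fun a b c e ↦ if a = 0 ∧ b = 0 ∧ c = 0 ∧ e = 0 then 1 else 0

/-- Applied to the vacuum, `z` and `F` only shift within layer 0, `K` contributes a scalar and `E`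
shifts the layer. Distinct monomials thus give nonzero multiples of distinct delta functions, whence
linear independence. -/
lemma rep_monomial_vac (i l j m a b c e : ZMod d) :
    rep hq (monomial d (q 1) ((i, l), (j, m))) (vac d) a b c e =
      if a = i ∧ b = j ∧ c = l ∧ e = m then q (-j) ^ l.val else 0 := by
  have hv (a b c e : ZMod d) (h : a + 1 = 0 ∨ ∀ n b c e, (opF q ^ n) ((opz ^ m.val) (vac d))
      (a + 1) b c e = 0) := opF_pow_apply_of_eq_zero q j.val ((opz ^ m.val) (vac d)) a h b c e
  have h₀ : ∀ a ≠ 0, (opz ^ m.val) (vac d) a = 0 := by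
    intro a ha
    ext b c e
    simp [opz_pow_apply, vac, ha]
  have h₁ := opF_pow_apply_of_ne_zero q j.val _ h₀
  simp only [monomial, map_mul, map_pow, rep_E, rep_F, rep_K, rep_z, Module.End.mul_apply,
    opE_pow_apply, opK_pow_apply, ZMod.natCast_zmod_val]
  by_cases hi : a = i
  · subst hi
    rw [if_neg (lt_irrefl _), sub_self, zero_sub, hv 0]
    · by_cases hj : b = j
      · subst hj
        rw [if_neg (lt_irrefl _), opz_pow_apply]
        simp [vac, sub_eq_zero]
      · simp [hj, opz_pow_apply, vac, sub_eq_zero]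
    · by_cases h : (0 : ZMod d) + 1 = 0
      · exact .inl h
      · exact .inr fun n b c e ↦ by rw [opF_pow_apply_of_ne_zero q n _ h₀ _ h]; rfl
  · rw [h₁ _ (sub_ne_zero.2 hi)]
    simp [hi]

omit [NeZero d] in
lemma q_pow_ne_zero (j : ZMod d) (n : ℕ) : q j ^ n ≠ 0 :=
  pow_ne_zero _ (AddChar.val_isUnit q j).ne_zero

lemma rep_sum_vac (c : ZMod d × ZMod d → ZMod d × ZMod d → ℂ) (i l j m : ZMod d) :
    rep hq (∑ s, ∑ p, c p s • monomial d (q 1) (p, s)) (vac d) i j l m =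
      c (i, l) (j, m) * q (-j) ^ l.val := by
  simp only [map_sum, map_smul, LinearMap.sum_apply, LinearMap.smul_apply, Finset.sum_apply,
    Pi.smul_apply, smul_eq_mul]
  rw [Finset.sum_eq_single (j, m), Finset.sum_eq_single (i, l)]
  · rw [rep_monomial_vac, if_pos ⟨rfl, rfl, rfl, rfl⟩]
  · intro p _ hp
    rw [rep_monomial_vac, if_neg, mul_zero]
    rintro ⟨h₁, -, h₂, -⟩
    exact hp (Prod.ext h₁.symm h₂.symm)
  · simp
  · intro s _ hs
    refine Finset.sum_eq_zero fun p _ ↦ ?_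
    rw [rep_monomial_vac, if_neg, mul_zero]
    rintro ⟨-, h₁, -, h₂⟩
    exact hs (Prod.ext h₁.symm h₂.symm)
  · simp

omit [NeZero d] in
lemma q_one_ne_zero : q 1 ≠ 0 := (AddChar.val_isUnit q 1).ne_zero

include hq in
lemma coeff_eq_zero (c : ZMod d × ZMod d → ZMod d × ZMod d → ℂ)
    (h : ∑ s, ∑ p, c p s • monomial d (q 1) (p, s) = 0) (p s : ZMod d × ZMod d) : c p s = 0 := by
  have := rep_sum_vac hq c p.1 p.2 s.1 s.2
  rw [h, map_zero] at this
  exact (mul_eq_zero.1 this.symm).resolve_right (q_pow_ne_zero _ _)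

lemma eq_zero_of_rep_vac_eq_zero {x : TaftDouble d (q 1)} (h : rep hq x (vac d) = 0) : x = 0 := by
  obtain ⟨c, rfl⟩ := exists_eq_sum d q_one_ne_zero x
  have hc (p s) : c p s = 0 := by
    have := rep_sum_vac hq c p.1 p.2 s.1 s.2
    rw [h] at this
    exact (mul_eq_zero.1 this.symm).resolve_right (q_pow_ne_zero _ _)
  simp [hc]

/-- The value at a given exponent, as a linear form on the double. -/
noncomputable def coeffForm (a b c e : ZMod d) : TaftDouble d (q 1) →ₗ[ℂ] ℂ :=
  LinearMap.proj e ∘ₗ LinearMap.proj c ∘ₗ LinearMap.proj b ∘ₗ LinearMap.proj a ∘ₗ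
    LinearMap.applyₗ (vac d) ∘ₗ (rep hq).toLinearMap

lemma coeffForm_apply (a b c e : ZMod d) (x : TaftDouble d (q 1)) :
    coeffForm hq a b c e x = rep hq x (vac d) a b c e := rfl

lemma isFrobeniusForm_coeffForm : IsFrobeniusForm (coeffForm hq (-1) (-1) 0 0) := by
  intro x hx
  apply eq_zero_of_rep_vac_eq_zero hq
  ext a b c e
  -- This multiplier brings the coefficient at `(a, b, c, e)` to `(-1, -1, 0, 0)`. `E` acts first
  -- because `F` is a pure shift only on the top layer; once `a = b = -1`, `K` acts without a
  -- scalar.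
  have := hx (gen d (q 1) .K ^ (-c).val * gen d (q 1) .z ^ (-e).val *
    gen d (q 1) .F ^ (-1 - b).val * gen d (q 1) .E ^ (-1 - a).val)
  rw [coeffForm_apply] at this
  change rep hq x (vac d) a b c e = 0
  simpa only [map_mul, map_pow, rep_E, rep_F, rep_K, rep_z, Module.End.mul_apply,
    opK_pow_apply, ZMod.natCast_zmod_val, opz_pow_apply, opF_pow_apply_neg_one,
    (val_le_val_neg_one _).not_gt, if_false, opE_pow_apply_neg_one, sub_sub_cancel, zero_sub,
    neg_neg, sub_self, AddChar.map_zero_eq_one, one_pow, one_mul] using this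

include hq in
lemma frobeniusModules : FrobeniusModules ℂ (TaftDouble d (q 1)) :=
  have := finite d (q_one_ne_zero (q := q))
  (isFrobeniusForm_coeffForm hq).frobeniusModules

/-- Combinations of the `F ^ j z ^ m` with coefficients in the Taft algebra, in monomials. -/
lemma sum_toDouble_mul (c : ZMod d × ZMod d → ZMod d × ZMod d → ℂ) :
    ∑ s : ZMod d × ZMod d, TaftAlg.toDouble d (q 1) (∑ p, c p s • TaftAlg.monomial d (q 1) p) *
      (gen d (q 1) .F ^ s.1.val * gen d (q 1) .z ^ s.2.val) =
    ∑ s, ∑ p, c p s • monomial d (q 1) (p, s) := by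
  refine Finset.sum_congr rfl fun s _ ↦ ?_
  rw [map_sum, Finset.sum_mul]
  refine Finset.sum_congr rfl fun p _ ↦ ?_
  rw [map_smul, smul_mul_assoc, toDouble_monomial_mul]

end TaftDouble

namespace TaftAlg

open TaftDouble

variable {d : ℕ} [NeZero d] {q : AddChar (ZMod d) ℂ} (hq : q 1 ≠ 1)

/-- The Taft algebra occupies the exponents where `F` and `z` do not occur, so its coefficients can
be read off in the double. -/
lemma rep_toDouble_sum_vac (c : ZMod d → ZMod d → ℂ) (i l : ZMod d) :
    rep hq (toDouble d (q 1) (∑ i, ∑ l, c i l • monomial d (q 1) (i, l))) (vac d) i 0 l 0 =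
      c i l := by
  have h : toDouble d (q 1) (∑ i, ∑ l, c i l • monomial d (q 1) (i, l)) =
      ∑ s, ∑ p, (if s = 0 then c p.1 p.2 else 0) • TaftDouble.monomial d (q 1) (p, s) := by
    rw [Finset.sum_eq_single (0 : ZMod d × ZMod d)]
    · simp only [map_sum, map_smul, if_true, Fintype.sum_prod_type]
      refine Finset.sum_congr rfl fun i _ ↦ Finset.sum_congr rfl fun l _ ↦ ?_
      have := toDouble_monomial_mul d (q 1) i l 0 0
      rw [ZMod.val_zero, pow_zero, pow_zero, mul_one, mul_one] at this
      rw [this]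
      rfl
    · intro s _ hs
      simp [hs]
    · simp
  rw [h, rep_sum_vac hq]
  simp

lemma isFrobeniusForm_coeffForm :
    IsFrobeniusForm (coeffForm hq (-1) 0 0 0 ∘ₗ (toDouble d (q 1)).toLinearMap) := by
  intro x hx
  obtain ⟨c, rfl⟩ := exists_eq_sum d (q 1) x
  have hc (i l) : c i l = 0 := by
    -- The coefficient at `(i, l)` is moved to the top power of `E`, up to a nonzero scalar coming
    -- from `K`.
    have := hx (gen d (q 1) .K ^ (-l).val * gen d (q 1) .E ^ (-1 - i).val)
    rw [LinearMap.comp_apply, AlgHom.toLinearMap_apply, coeffForm_apply] at this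
    simpa only [map_mul, map_pow, toDouble_K, toDouble_E, rep_E, rep_K, Module.End.mul_apply,
      Fun.opK_pow_apply, ZMod.natCast_zmod_val, Fun.opE_pow_apply_neg_one, zero_sub, neg_neg,
      rep_toDouble_sum_vac, mul_eq_zero, q_pow_ne_zero, false_or] using this
  simp [hc]

end TaftAlg

/-! ### Modules over the double that are projective over the Taft algebra -/

section SplitExact

variable {R M N P : Type*} [Ring R] [AddCommGroup M] [AddCommGroup N] [AddCommGroup P]
  [Module R M] [Module R N] [Module R P] {f : M →ₗ[R] N} {g : N →ₗ[R] P}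

lemma Function.Exact.nonempty_equiv_prod_of_projective (h : Function.Exact f g)
    (hf : Function.Injective f) (hg : Function.Surjective g) [Module.Projective R P] :
    Nonempty (N ≃ₗ[R] M × P) :=
  have ⟨l, hl⟩ := Module.projective_lifting_property g LinearMap.id hg
  ⟨(h.splitSurjectiveEquiv hf ⟨l, hl⟩).1⟩

lemma Function.Exact.projective₂ (h : Function.Exact f g)
    (hf : Function.Injective f) (hg : Function.Surjective g) [Module.Projective R M]
    [Module.Projective R P] : Module.Projective R N :=
  have ⟨e⟩ := h.nonempty_equiv_prod_of_projective hf hg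
  Module.Projective.of_equiv e.symm

lemma Function.Exact.projective₁ (h : Function.Exact f g)
    (hf : Function.Injective f) (hg : Function.Surjective g) [Module.Projective R N]
    [Module.Projective R P] : Module.Projective R M :=
  have ⟨e⟩ := h.nonempty_equiv_prod_of_projective hf hg
  have := Module.Projective.of_equiv e
  Module.Projective.of_split (LinearMap.inl R M P) (LinearMap.fst R M P) rfl

lemma Function.Exact.projective₃ {M N P : Type*} [AddCommGroup M] [AddCommGroup N]
    [AddCommGroup P] [Module R M] [Module R N] [Module R P] {f : M →ₗ[R] N} {g : N →ₗ[R] P}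
    (h : Function.Exact f g) (hg : Function.Surjective g) (l : N →ₗ[R] M)
    (hl : l ∘ₗ f = LinearMap.id) [Module.Projective R N] : Module.Projective R P :=
  have := Module.Projective.of_equiv (h.splitInjectiveEquiv hg ⟨l, hl⟩).1
  Module.Projective.of_split (LinearMap.inr R M P) (LinearMap.snd R M P) rfl

end SplitExact

section

variable {k A : Type} [Field k] [Ring A] [Algebra k A]

/-- Stably, `i ≫ r` differs from the identity by some `a ≫ b` through a projective `Q`; adding `-a`
and `b` as components through `Q` corrects the difference exactly. -/
lemma FDMod.exists_comp_eq_of_toStable {M N : FDMod k A}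
    (h : Retract ((toStable k A).obj M) ((toStable k A).obj N)) :
    ∃ (Q : FDMod k A) (_ : FDMod.proj k A Q) (f : M ⟶ N.prod Q) (g : N.prod Q ⟶ M),
      f ≫ g = 𝟙 M := by
  obtain ⟨i, hi⟩ := (toStable k A).map_surjective h.i
  obtain ⟨r, hr⟩ := (toStable k A).map_surjective h.r
  have := h.retract
  rw [← hi, ← hr, ← Functor.map_comp, ← CategoryTheory.Functor.map_id, toStable_map_eq_iff] at this
  obtain ⟨Q, hQ, a, b, hab⟩ := this
  refine ⟨Q, hQ,
    ObjectProperty.homMk (ModuleCat.ofHom (LinearMap.prod i.hom.hom (-a.hom.hom))),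
    ObjectProperty.homMk (ModuleCat.ofHom (LinearMap.coprod r.hom.hom b.hom.hom)), ?_⟩
  rw [sub_eq_iff_eq_add, ← sub_eq_iff_eq_add', sub_eq_add_neg] at hab
  rw [← hab]
  ext x
  change r.hom.hom (i.hom.hom x) + b.hom.hom (-a.hom.hom x) =
    r.hom.hom (i.hom.hom x) + -b.hom.hom (a.hom.hom x)
  rw [map_neg]

end

section

variable {d : ℕ} [NeZero d] {q : AddChar (ZMod d) ℂ} (hq : q 1 ≠ 1)

/-- The restriction of modules to the Taft algebra. -/
noncomputable abbrev resTaft (d : ℕ) (ζ : ℂ) :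
    ModuleCat.{0} (TaftDouble d ζ) ⥤ ModuleCat.{0} (TaftAlg d ζ) :=
  ModuleCat.restrictScalars (TaftAlg.toDouble d ζ).toRingHom

include hq in
/-- The double is free over the Taft algebra. -/
lemma TaftDouble.projective_res_self : Module.Projective (TaftAlg d (q 1))
    ((resTaft d (q 1)).obj (ModuleCat.of _ (TaftDouble d (q 1)))) := by
  let R := (resTaft d (q 1)).obj (ModuleCat.of _ (TaftDouble d (q 1)))
  let v (s : ZMod d × ZMod d) : R :=
    (gen d (q 1) .F ^ s.1.val * gen d (q 1) .z ^ s.2.val : TaftDouble d (q 1))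
  let Ψ : (ZMod d × ZMod d → TaftAlg d (q 1)) →ₗ[TaftAlg d (q 1)] R :=
    Fintype.linearCombination (TaftAlg d (q 1)) v
  have hΨ (c : ZMod d × ZMod d → ZMod d × ZMod d → ℂ) :
      Ψ (fun s ↦ ∑ p, c p s • TaftAlg.monomial d (q 1) p) =
        (∑ s, ∑ p, c p s • monomial d (q 1) (p, s) : TaftDouble d (q 1)) :=
    sum_toDouble_mul c
  refine Module.Projective.of_equiv (LinearEquiv.ofBijective Ψ ⟨?_, ?_⟩)
  · refine (injective_iff_map_eq_zero Ψ).2 fun x hx ↦ ?_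
    choose c hc using fun s ↦ TaftAlg.exists_eq_sum d (q 1) (x s)
    have hx' : x = fun s ↦ ∑ p : ZMod d × ZMod d, c s p.1 p.2 • TaftAlg.monomial d (q 1) p := by
      ext1 s
      rw [hc, Fintype.sum_prod_type]
    -- The images of the coefficients are coordinates in the monomial basis of the double, so they
    -- all vanish.
    rw [hx', hΨ (fun p s ↦ c s p.1 p.2)] at hx
    have h0 := coeff_eq_zero hq _ hx
    rw [hx']
    ext1 s
    exact Finset.sum_eq_zero fun p _ ↦ by rw [h0 p s, zero_smul]
  · intro y
    obtain ⟨c, hc⟩ := exists_eq_sum d (q_one_ne_zero (q := q)) y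
    exact ⟨_, (hΨ c).trans hc.symm⟩

include hq in
lemma TaftDouble.proj_le_projOverTaft :
    FDMod.proj ℂ (TaftDouble d (q 1)) ≤ projOverTaft d (q 1) := by
  intro P hP
  have : Module.Projective (TaftDouble d (q 1)) P.obj := hP
  have := P.finite_restrictScalars
  have hA := TaftDouble.projective_res_self hq
  obtain ⟨n, p, s, -, -, hps⟩ := Module.Finite.exists_comp_eq_id_of_projective
    (TaftDouble d (q 1)) P.obj
  have : Module.Projective (TaftAlg d (q 1)) ((resTaft d (q 1)).obj
      (ModuleCat.of _ (Fin n → TaftDouble d (q 1)))) :=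
    Module.Projective.of_equiv (DirectSum.linearEquivFunOnFintype (TaftAlg d (q 1)) (Fin n)
      (fun _ ↦ (resTaft d (q 1)).obj (ModuleCat.of _ (TaftDouble d (q 1)))))
  exact Module.Projective.of_split ((resTaft d (q 1)).map (ModuleCat.ofHom s)).hom
    ((resTaft d (q 1)).map (ModuleCat.ofHom p)).hom
    (LinearMap.ext fun x ↦ LinearMap.congr_fun hps x)

include hq in
-- The correction term `Q` is projective over the double, hence over the Taft algebra, and `M` is a
-- genuine summand of `N ⊕ Q`.
lemma projOverTaft_of_retract {M N : FDMod ℂ (TaftDouble d (q 1))}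
    (h : Retract ((toStable ℂ (TaftDouble d (q 1))).obj M) ((toStable ℂ _).obj N))
    (hN : projOverTaft d (q 1) N) : projOverTaft d (q 1) M := by
  obtain ⟨Q, hQ, f, g, hfg⟩ := FDMod.exists_comp_eq_of_toStable h
  have h₁ : Module.Projective (TaftAlg d (q 1)) ((resTaft d (q 1)).obj N.obj) := hN
  have h₂ : Module.Projective (TaftAlg d (q 1)) ((resTaft d (q 1)).obj Q.obj) :=
    TaftDouble.proj_le_projOverTaft hq _ hQ
  have : Module.Projective (TaftAlg d (q 1)) ((resTaft d (q 1)).obj (N.prod Q).obj) :=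
    inferInstanceAs (Module.Projective (TaftAlg d (q 1))
      ((resTaft d (q 1)).obj N.obj × (resTaft d (q 1)).obj Q.obj))
  exact Module.Projective.of_split ((resTaft d (q 1)).map f.hom).hom
    ((resTaft d (q 1)).map g.hom).hom
    (LinearMap.ext fun x ↦ LinearMap.congr_fun (congr_arg (fun φ ↦ φ.hom.hom) hfg) x)

namespace FDMod.IsShortExact

variable {S : ShortComplex (FDMod ℂ (TaftDouble d (q 1)))} (hS : FDMod.IsShortExact S)

include hS

omit [NeZero d] in
lemma projOverTaft₂ (h₁ : projOverTaft d (q 1) S.X₁) (h₃ : projOverTaft d (q 1) S.X₃) :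
    projOverTaft d (q 1) S.X₂ :=
  have : Module.Projective (TaftAlg d (q 1)) ((resTaft d (q 1)).obj S.X₁.obj) := h₁
  have : Module.Projective (TaftAlg d (q 1)) ((resTaft d (q 1)).obj S.X₃.obj) := h₃
  Function.Exact.projective₂ (f := ((resTaft d (q 1)).map S.f.hom).hom)
    (g := ((resTaft d (q 1)).map S.g.hom).hom) hS.2.1 hS.1 hS.2.2

omit [NeZero d] in
lemma projOverTaft₁ (h₂ : projOverTaft d (q 1) S.X₂) (h₃ : projOverTaft d (q 1) S.X₃) :
    projOverTaft d (q 1) S.X₁ :=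
  have : Module.Projective (TaftAlg d (q 1)) ((resTaft d (q 1)).obj S.X₂.obj) := h₂
  have : Module.Projective (TaftAlg d (q 1)) ((resTaft d (q 1)).obj S.X₃.obj) := h₃
  Function.Exact.projective₁ (f := ((resTaft d (q 1)).map S.f.hom).hom)
    (g := ((resTaft d (q 1)).map S.g.hom).hom) hS.2.1 hS.1 hS.2.2

include hq in
-- The first term is a finite-dimensional projective over the Taft algebra, hence injective by its
-- Frobenius form, so the inclusion splits over `B`.
lemma projOverTaft₃ (h₁ : projOverTaft d (q 1) S.X₁) (h₂ : projOverTaft d (q 1) S.X₂) :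
    projOverTaft d (q 1) S.X₃ := by
  have : Module.Projective (TaftAlg d (q 1)) ((resTaft d (q 1)).obj S.X₁.obj) := h₁
  have : Module.Projective (TaftAlg d (q 1)) ((resTaft d (q 1)).obj S.X₂.obj) := h₂
  have : Module.Finite (TaftAlg d (q 1)) ((resTaft d (q 1)).obj S.X₁.obj) := by
    let _ : Module ℂ ((resTaft d (q 1)).obj S.X₁.obj) := S.X₁.module
    have : Module.Finite ℂ ((resTaft d (q 1)).obj S.X₁.obj) := S.X₁.property
    have : IsScalarTower ℂ (TaftAlg d (q 1)) ((resTaft d (q 1)).obj S.X₁.obj) :=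
      .of_algebraMap_smul fun c (x : S.X₁.obj) ↦ by
        change TaftAlg.toDouble d (q 1) (algebraMap ℂ _ c) • x =
          algebraMap ℂ (TaftDouble d (q 1)) c • x
        rw [AlgHom.commutes]
    exact Module.Finite.of_restrictScalars_finite ℂ _ _
  obtain ⟨l, hl⟩ := ((TaftAlg.isFrobeniusForm_coeffForm hq).injective_of_projective
    ((resTaft d (q 1)).obj S.X₁.obj)).out ((resTaft d (q 1)).map S.f.hom).hom hS.1 LinearMap.id
  exact Function.Exact.projective₃ (f := ((resTaft d (q 1)).map S.f.hom).hom)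
    (g := ((resTaft d (q 1)).map S.g.hom).hom) hS.2.1 hS.2.2 l (LinearMap.ext hl)

end FDMod.IsShortExact

omit [NeZero d] in
-- The quotient functor is bijective on objects, so the strict image loses no information about the
-- module.
lemma stableProjOverTaft_iff (X : StableCat ℂ (TaftDouble d (q 1))) :
    stableProjOverTaft d (q 1) X ↔ projOverTaft d (q 1) X.as :=
  ⟨by rintro ⟨M, hM⟩; exact hM, fun h ↦ ⟨X.as, h⟩⟩

include hq in
lemma stableProjOverTaft_isStableUnderRetracts :
    (stableProjOverTaft d (q 1)).IsStableUnderRetracts where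
  of_retract {X Y} h hY := (stableProjOverTaft_iff X).2
    (projOverTaft_of_retract hq (M := X.as) (N := Y.as) h ((stableProjOverTaft_iff Y).1 hY))

end

/-! ### The shift for an arbitrary standard triangulation -/

section

variable {k A : Type} [Field k] [Ring A] [Algebra k A] [StableTriangulation k A]

lemma StableTriangulation.connecting_distinguished (S : ShortComplex (FDMod k A))
    (hS : FDMod.IsShortExact S) : Triangle.mk ((toStable k A).map S.f) ((toStable k A).map S.g)
      (connecting S hS) ∈ distTriang (StableCat k A) :=
  (distinguished_iff _).2 ⟨S, hS, ⟨Iso.refl _⟩⟩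

/-- Short exact sequences with projective middle term compute the shift. -/
noncomputable def StableTriangulation.shiftIso (S : ShortComplex (FDMod k A))
    (hS : FDMod.IsShortExact S) (hP : FDMod.proj k A S.X₂) :
    (toStable k A).obj S.X₃ ≅ ((toStable k A).obj S.X₁)⟦(1 : ℤ)⟧ :=
  have : IsIso (connecting S hS) :=
    (Triangle.isZero₂_iff_isIso₃ _ (connecting_distinguished S hS)).1 (FDMod.isZero_toStable hP)
  asIso (connecting S hS)

end

/-! ### Closure under shifts and extensions -/

section

variable {d : ℕ} [NeZero d] {q : AddChar (ZMod d) ℂ} (hq : q 1 ≠ 1)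
  [StableTriangulation ℂ (TaftDouble d (q 1))]

include hq

lemma stableProjOverTaft_isTriangulated : (stableProjOverTaft d (q 1)).IsTriangulated := by
  have := stableProjOverTaft_isStableUnderRetracts hq
  have := TaftDouble.frobeniusModules hq
  have h₀ : (stableProjOverTaft d (q 1)).ContainsZero := by
    obtain ⟨Z, -⟩ := HasZeroObject.zero (C := StableCat ℂ (TaftDouble d (q 1)))
    -- Any projective module will do as a zero object of the stable category.
    obtain ⟨P, hP, -⟩ := FrobeniusModules.exists_injective (k := ℂ) Z.as
    exact ⟨_, FDMod.isZero_toStable hP, ⟨P, TaftDouble.proj_le_projOverTaft hq _ hP⟩⟩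
  have h₁ : (stableProjOverTaft d (q 1)).IsStableUnderShift ℤ := by
    refine ObjectProperty.isStableUnderShift_int _ ?_ ?_
    · rintro _ ⟨M, hM⟩
      obtain ⟨P, hP, f, hf⟩ := FrobeniusModules.exists_injective (k := ℂ) M
      obtain ⟨C, g, w, h⟩ := FDMod.exists_cokernel f hf
      exact ObjectProperty.prop_of_iso _ (StableTriangulation.shiftIso _ h hP)
        ⟨C, h.projOverTaft₃ hq hM (TaftDouble.proj_le_projOverTaft hq _ hP)⟩
    · rintro _ ⟨M, hM⟩
      obtain ⟨P, hP, g, hg⟩ := FrobeniusModules.exists_surjective (k := ℂ) M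
      obtain ⟨K, f, w, h⟩ := FDMod.exists_kernel g hg
      exact ObjectProperty.prop_of_iso _
        (((shiftFunctorCompIsoId (StableCat ℂ (TaftDouble d (q 1))) (1 : ℤ) (-1)
          (by simp)).app _).symm ≪≫ (shiftFunctor _ (-1 : ℤ)).mapIso
          (StableTriangulation.shiftIso _ h hP).symm)
        ⟨K, h.projOverTaft₁ (TaftDouble.proj_le_projOverTaft hq _ hP) hM⟩
  have h₂ : (stableProjOverTaft d (q 1)).IsTriangulatedClosed₂ := .mk' fun T hT hT₁ hT₃ ↦ by
    obtain ⟨S, hS, ⟨e⟩⟩ := (StableTriangulation.distinguished_iff T).1 hT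
    have h₁ := ObjectProperty.prop_of_iso _ (Triangle.π₁.mapIso e) hT₁
    have h₃ := ObjectProperty.prop_of_iso _ (Triangle.π₃.mapIso e) hT₃
    exact ObjectProperty.prop_of_iso _ (Triangle.π₂.mapIso e).symm ⟨S.X₂, hS.projOverTaft₂
      ((stableProjOverTaft_iff _).1 h₁) ((stableProjOverTaft_iff _).1 h₃)⟩
  constructor

end

theorem mainTheorem6 (d : ℕ) (hd : 2 ≤ d) (ζ : ℂ) (hζ : IsPrimitiveRoot ζ d) :
    Nonempty (StableTriangulation ℂ (TaftDouble d ζ)) ∧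
    ∀ [StableTriangulation ℂ (TaftDouble d ζ)],
      (stableProjOverTaft d ζ).IsClosedUnderIsomorphisms ∧
      (stableProjOverTaft d ζ).IsStableUnderRetracts ∧
      ∃ _ : (stableProjOverTaft d ζ).IsTriangulated,
        IsTriangulated (StableOverTaft d ζ) ∧ (toStableOverTaft d ζ).IsTriangulated := by
  have : NeZero d := ⟨by lia⟩
  -- Encoding `ζ` as a character lets powers of `ζ` have exponents in `ZMod d`, as in the regular
  -- representation.
  obtain ⟨q, rfl⟩ : ∃ q : AddChar (ZMod d) ℂ, q 1 = ζ := by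
    refine ⟨AddChar.zmodChar d hζ.pow_eq_one, ?_⟩
    simpa using AddChar.zmodChar_apply' hζ.pow_eq_one 1
  have hq : q 1 ≠ 1 := hζ.ne_one (by lia)
  have := TaftDouble.frobeniusModules hq
  refine ⟨nonempty_stableTriangulation ℂ _, ?_⟩
  intro _
  have := stableProjOverTaft_isStableUnderRetracts hq
  exact ⟨inferInstance, this, stableProjOverTaft_isTriangulated hq, inferInstance, inferInstance⟩
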